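/- Let $n\ge 1$, let $\Omega\subset\mathbb{R}^n$ be a bounded open set (for instance a bounded Lipschitz domain), and let $s\in(0,1)$. All functions are real-valued. Let $H^s(\mathbb{R}^n)=\{v\in L^2(\mathbb{R}^n):(1+|\xi|^2)^{s/2}\mathcal F(v)\in L^2(\mathbb{R}^n)\}$, where $\mathcal F(v)(\xi)=\int_{\mathbb{R}^n} e^{-2\pi i x\cdot\xi}v(x)\,dx$ (extended to $L^2(\mathbb{R}^n)$ by Plancherel), with the norm $\|v\|_{H^s(\mathbb{R}^n)}=\|(1+|\xi|^2)^{s/2}\mathcal F(v)\|_{L^2(\mathbb{R}^n)}$. Let $\tilde H^s(\Omega)$ be the closure of $C_0^\infty(\Omega)$ in $H^s(\mathbb{R}^n)$, with the norm of $H^s(\mathbb{R}^n)$, and let $H^{-s}(\Omega)$ be its dual space, with the dual norm and the duality pairing $\langle\cdot,\cdot\rangle$. Put $$\mathcal A(v,w)=\frac{C(n,s)}2\iint_{\mathbb{R}^n\times\mathbb{R}^n}\frac{(v(x)-v(y))(w(x)-w(y))}{|x-y|^{n+2s}}\,dx\,dy,\qquad C(n,s)=\frac{2^{2s}\,s\,\Gamma(s+\frac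 n2)}{\pi^{n/2}\,\Gamma(1-s)}.$$ For $T>0$ let $$\mathbb V=\{v\in L^2(0,T;\tilde H^s(\Omega))\cap L^\infty(0,T;L^2(\Omega)):\ \partial_t v\in L^2(0,T;H^{-s}(\Omega))\},$$ where $\partial_t v$ is the distributional derivative on $(0,T)$, an element $w\in\tilde H^s(\Omega)$ being identified with the functional $\varphi\mapsto(w,\varphi)_{L^2(\Omega)}$ in $H^{-s}(\Omega)$. Given $f,z\in L^2(0,T;H^{-s}(\Omega))$ and $u_0\in L^2(\Omega)$, a weak solution of the fractional heat equation $\partial_t u+(-\Delta)^s u=f+z$ in $\Omega\times(0,T)$, $u=0$ in $(\mathbb{R}^n\setminus\Omega)\times(0,T)$, $u(0)=u_0$ in $\Omega$, is a function $u\in\mathbb V$ such that $u(0)=u_0$ (that is, $u$ has a representative in $C([0,T];L^2(\Omega))$ with the value $u_0$ at $t=0$) and, for almost every $t\in(0,T)$, $$\langle\partial_t u(t),\varphi\rangle+\mathcal A(u(t),\varphi)=\langle f(t)+z(t),\varphi\rangle\qquad\text{for all }\varphi\in\tilde H^s(\Omega).$$ **Theorem.** For all $T>0$, $f,z\in L^2(0,T;H^{-s}(\Omega))$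 and $u_0\in L^2(\Omega)$ there is exactly one weak solution $u\in\mathbb V$. Moreover, there is a constant $C>0$ that depends only on $n$, $s$ and $\Omega$ (not on $T$, $f$, $z$, $u_0$ or $u$) such that the solution satisfies $$\|u\|_{L^\infty(0,T;L^2(\Omega))}+\|u\|_{L^2(0,T;H^s(\mathbb{R}^n))}\le C\left(\|u_0\|_{L^2(\Omega)}^2+\|f+z\|_{L^2(0,T;H^{-s}(\Omega))}^2\right)^{1/2}.$$ -/

import Mathlib

open MeasureTheory Set
open scoped ENNReal ContDiff

noncomputable section

namespace FracHeat

/-- The Euclidean space `ℝⁿ`. -/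
abbrev Rn (n : ℕ) : Type := EuclideanSpace ℝ (Fin n)

/-! ### The Sobolev space `H^s(ℝⁿ)` of real-valued functions -/

/-- The Fourier transform of a real-valued `L²` function on `ℝⁿ`
(with the kernel `exp (-2πi ⟪x, ξ⟫)`). -/
def fourierL2 (n : ℕ) :
    Lp ℝ 2 (volume : Measure (Rn n)) →ₗ[ℝ] Lp ℂ 2 (volume : Measure (Rn n)) :=
  ((Lp.fourierTransformₗᵢ (Rn n) ℂ).toLinearEquiv.toLinearMap.restrictScalars ℝ).comp
    (Complex.ofRealCLM.compLpL 2 volume).toLinearMap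

/-- The function `ξ ↦ (1 + |ξ|²)^(s/2) 𝓕(v)(ξ)`. -/
def weightedFourier (n : ℕ) (s : ℝ) (v : Lp ℝ 2 (volume : Measure (Rn n))) (ξ : Rn n) : ℂ :=
  ((1 + ‖ξ‖ ^ 2) ^ (s / 2) : ℝ) • (fourierL2 n v : Rn n → ℂ) ξ

theorem weightedFourier_add (n : ℕ) (s : ℝ) (v w : Lp ℝ 2 (volume : Measure (Rn n))) :
    weightedFourier n s (v + w) =ᵐ[volume] weightedFourier n s v + weightedFourier n s w := by
  filter_upwards [Lp.coeFn_add (fourierL2 n v) (fourierL2 n w)] with ξ hξ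
  simp only [weightedFourier, map_add, Pi.add_apply, hξ, smul_add]

theorem weightedFourier_smul (n : ℕ) (s c : ℝ) (v : Lp ℝ 2 (volume : Measure (Rn n))) :
    weightedFourier n s (c • v) =ᵐ[volume] c • weightedFourier n s v := by
  filter_upwards [Lp.coeFn_smul c (fourierL2 n v)] with ξ hξ
  simp only [weightedFourier, map_smul, Pi.smul_apply, hξ]
  exact smul_comm _ _ _

/-- `H^s(ℝⁿ) = {v ∈ L²(ℝⁿ) : (1 + |ξ|²)^(s/2) 𝓕(v) ∈ L²(ℝⁿ)}` as a subspace of `L²(ℝⁿ)`. -/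
def sobolevSubmodule (n : ℕ) (s : ℝ) : Submodule ℝ (Lp ℝ 2 (volume : Measure (Rn n))) where
  carrier := {v | MemLp (weightedFourier n s v) 2 volume}
  add_mem' {v w} hv hw :=
    (memLp_congr_ae (weightedFourier_add n s v w)).2 (MemLp.add hv hw)
  zero_mem' := by
    have h : weightedFourier n s 0 =ᵐ[volume] (0 : Rn n → ℂ) := by
      filter_upwards [Lp.coeFn_zero ℂ 2 (volume : Measure (Rn n))] with ξ hξ
      simp only [weightedFourier, map_zero, hξ, Pi.zero_apply, smul_zero]
    exact (memLp_congr_ae h).2 MemLp.zero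
  smul_mem' c v hv :=
    (memLp_congr_ae (weightedFourier_smul n s c v)).2 (MemLp.const_smul hv c)

/-- `H^s(ℝⁿ)` as a type of its own: it does not carry the `L²` norm of the ambient space, but
the norm `‖v‖_{H^s(ℝⁿ)} = ‖(1 + |ξ|²)^(s/2) 𝓕(v)‖_{L²(ℝⁿ)}` (see below). -/
def Sobolev (n : ℕ) (s : ℝ) : Type := ↥(sobolevSubmodule n s)

instance (n : ℕ) (s : ℝ) : AddCommGroup (Sobolev n s) :=
  inferInstanceAs (AddCommGroup ↥(sobolevSubmodule n s))

instance (n : ℕ) (s : ℝ) : Module ℝ (Sobolev n s) :=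
  inferInstanceAs (Module ℝ ↥(sobolevSubmodule n s))

/-- The inclusion `H^s(ℝⁿ) ⊆ L²(ℝⁿ)`. -/
def Sobolev.toL2 (n : ℕ) (s : ℝ) : Sobolev n s →ₗ[ℝ] Lp ℝ 2 (volume : Measure (Rn n)) :=
  (sobolevSubmodule n s).subtype

theorem Sobolev.memLp (n : ℕ) (s : ℝ) (v : Sobolev n s) :
    MemLp (weightedFourier n s (Sobolev.toL2 n s v)) 2 volume :=
  v.property

/-- The map `v ↦ (1 + |ξ|²)^(s/2) 𝓕(v)` from `H^s(ℝⁿ)` to `L²(ℝⁿ; ℂ)`. -/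
def Sobolev.weighted (n : ℕ) (s : ℝ) :
    Sobolev n s →ₗ[ℝ] Lp ℂ 2 (volume : Measure (Rn n)) where
  toFun v := MemLp.toLp (weightedFourier n s (Sobolev.toL2 n s v)) (Sobolev.memLp n s v)
  map_add' v w := by
    refine (MemLp.toLp_congr _ ((Sobolev.memLp n s v).add (Sobolev.memLp n s w)) ?_).trans
      (MemLp.toLp_add _ _)
    rw [map_add]
    exact weightedFourier_add n s _ _
  map_smul' c v := by
    refine (MemLp.toLp_congr _ ((Sobolev.memLp n s v).const_smul c) ?_).trans
      (MemLp.toLp_const_smul c _)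
    rw [map_smul]
    exact weightedFourier_smul n s c _

theorem Sobolev.weighted_injective (n : ℕ) (s : ℝ) :
    Function.Injective (Sobolev.weighted n s) := by
  rw [injective_iff_map_eq_zero]
  intro v hv
  have h1 : weightedFourier n s (Sobolev.toL2 n s v) =ᵐ[volume] (0 : Rn n → ℂ) :=
    (MemLp.toLp_eq_toLp_iff (Sobolev.memLp n s v) MemLp.zero).1 (hv.trans (MemLp.toLp_zero _).symm)
  have h2 : fourierL2 n (Sobolev.toL2 n s v) = 0 := by
    rw [Lp.eq_zero_iff_ae_eq_zero]
    filter_upwards [h1] with ξ hξ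
    have hpos : (0 : ℝ) < (1 + ‖ξ‖ ^ 2) ^ (s / 2) := by positivity
    exact (smul_eq_zero.1 hξ).resolve_left hpos.ne'
  have h3 : Complex.ofRealCLM.compLp (Sobolev.toL2 n s v) = 0 :=
    (Lp.fourierTransformₗᵢ (Rn n) ℂ).map_eq_zero_iff.1 h2
  have h4 : Sobolev.toL2 n s v = 0 := by
    rw [Lp.eq_zero_iff_ae_eq_zero]
    filter_upwards [Complex.ofRealCLM.coeFn_compLp (Sobolev.toL2 n s v),
      (Lp.eq_zero_iff_ae_eq_zero).1 h3] with x hx hx'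
    rw [hx'] at hx
    simpa using hx.symm
  exact Subtype.ext h4

/-- The norm of `H^s(ℝⁿ)`: `‖v‖_{H^s(ℝⁿ)} = ‖(1 + |ξ|²)^(s/2) 𝓕(v)‖_{L²(ℝⁿ)}`. -/
instance (n : ℕ) (s : ℝ) : NormedAddCommGroup (Sobolev n s) :=
  NormedAddCommGroup.induced _ _ (Sobolev.weighted n s) (Sobolev.weighted_injective n s)

instance (n : ℕ) (s : ℝ) : NormedSpace ℝ (Sobolev n s) :=
  NormedSpace.induced ℝ (Sobolev n s) _ (Sobolev.weighted n s)

/-! ### The spaces `H̃^s(Ω)` and `H^{-s}(Ω)` -/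

/-- The elements of `H^s(ℝⁿ)` that are (almost everywhere equal to) a function in
`C_0^∞(Ω)`. -/
def testFunctions (n : ℕ) (s : ℝ) (Ω : Set (Rn n)) : Submodule ℝ (Sobolev n s) where
  carrier := {v | ∃ φ : Rn n → ℝ, ContDiff ℝ ∞ φ ∧ HasCompactSupport φ ∧ tsupport φ ⊆ Ω ∧
    Sobolev.toL2 n s v =ᵐ[volume] φ}
  add_mem' := by
    rintro v w ⟨φ, h1, h2, h3, h4⟩ ⟨ψ, k1, k2, k3, k4⟩
    refine ⟨φ + ψ, h1.add k1, h2.add k2,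
      (tsupport_add φ ψ).trans (union_subset h3 k3), ?_⟩
    rw [map_add]
    exact (Lp.coeFn_add _ _).trans (h4.add k4)
  zero_mem' := by
    refine ⟨0, contDiff_const, HasCompactSupport.zero, by simp [tsupport], ?_⟩
    rw [map_zero]
    exact Lp.coeFn_zero _ _ _
  smul_mem' := by
    rintro c v ⟨φ, h1, h2, h3, h4⟩
    refine ⟨c • φ, contDiff_const.smul h1, h2.smul_left (f := fun _ => c),
      (closure_mono (Function.support_const_smul_subset c φ)).trans h3, ?_⟩
    rw [map_smul]
    exact (Lp.coeFn_smul _ _).trans (h4.const_smul c)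

/-- `H̃^s(Ω)`: the closure of `C_0^∞(Ω)` in `H^s(ℝⁿ)`, with the norm of `H^s(ℝⁿ)`. -/
abbrev Htilde (n : ℕ) (s : ℝ) (Ω : Set (Rn n)) : Submodule ℝ (Sobolev n s) :=
  (testFunctions n s Ω).topologicalClosure

/-- `H^{-s}(Ω)`: the dual space of `H̃^s(Ω)`, with the dual norm. -/
abbrev Hneg (n : ℕ) (s : ℝ) (Ω : Set (Rn n)) : Type := StrongDual ℝ (Htilde n s Ω)

/-- `L²(Ω)`. -/
abbrev L2 (n : ℕ) (Ω : Set (Rn n)) : Type := Lp ℝ 2 ((volume : Measure (Rn n)).restrict Ω)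

/-- The restriction `v ↦ v|_Ω`, from `H̃^s(Ω)` to `L²(Ω)`. -/
def restr (n : ℕ) (s : ℝ) (Ω : Set (Rn n)) : Htilde n s Ω →ₗ[ℝ] L2 n Ω :=
  ((LpToLpRestrictCLM (Rn n) ℝ ℝ volume 2 Ω).toLinearMap.comp (Sobolev.toL2 n s)).comp
    (Htilde n s Ω).subtype

/-! ### The bilinear form of the integral fractional Laplacian -/

/-- `C(n,s) = 2^{2s} s Γ(s + n/2) / (π^{n/2} Γ(1-s))`. -/
def constC (n : ℕ) (s : ℝ) : ℝ :=
  2 ^ (2 * s) * s * Real.Gamma (s + n / 2) / (Real.pi ^ ((n : ℝ) / 2) * Real.Gamma (1 - s))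

/-- `𝓐(v,w) = C(n,s)/2 ∬ (v(x) - v(y)) (w(x) - w(y)) / |x-y|^{n+2s} dx dy`, over `ℝⁿ × ℝⁿ`. -/
def formA (n : ℕ) (s : ℝ) (v w : Rn n → ℝ) : ℝ :=
  constC n s / 2 *
    ∫ p : Rn n × Rn n, (v p.1 - v p.2) * (w p.1 - w p.2) / ‖p.1 - p.2‖ ^ ((n : ℝ) + 2 * s)

/-- A representative on `ℝⁿ` of an element of `H̃^s(Ω)`. -/
def rep {n : ℕ} {s : ℝ} {Ω : Set (Rn n)} (v : Htilde n s Ω) : Rn n → ℝ :=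
  Sobolev.toL2 n s (v : Sobolev n s)

/-! ### Weak solutions of the fractional heat equation -/

/-- The Bochner space `L²(0,T;X)`. -/
abbrev L2Time (T : ℝ) (X : Type) [NormedAddCommGroup X] : Type :=
  Lp X 2 ((volume : Measure ℝ).restrict (Ioo 0 T))

/-- `g = ∂_t v` in the sense of `H^{-s}(Ω)`-valued distributions on `(0,T)`, where
`v(t) ∈ H̃^s(Ω)` is identified with the functional `φ ↦ (v(t), φ)_{L²(Ω)}`. -/
def IsTimeDeriv {n : ℕ} {s : ℝ} {Ω : Set (Rn n)} {T : ℝ}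
    (v : L2Time T (Htilde n s Ω)) (g : L2Time T (Hneg n s Ω)) : Prop :=
  ∀ η : ℝ → ℝ, ContDiff ℝ ∞ η → HasCompactSupport η → tsupport η ⊆ Ioo 0 T →
    ∀ φ : Htilde n s Ω,
      ∫ t in Ioo 0 T, deriv η t * inner ℝ (restr n s Ω (v t)) (restr n s Ω φ) =
        - ∫ t in Ioo 0 T, η t * g t φ

/-- `𝕍 = {v ∈ L²(0,T;H̃^s(Ω)) ∩ L^∞(0,T;L²(Ω)) : ∂_t v ∈ L²(0,T;H^{-s}(Ω))}`. -/
def spaceV (n : ℕ) (s : ℝ) (Ω : Set (Rn n)) (T : ℝ) : Set (L2Time T (Htilde n s Ω)) :=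
  {v | MemLp (fun t => restr n s Ω (v t)) ∞ (volume.restrict (Ioo 0 T)) ∧
    ∃ g : L2Time T (Hneg n s Ω), IsTimeDeriv v g}

/-- `v(0) = u₀`: the representative of `v` that is continuous from `[0,T]` to `L²(Ω)` takes the
value `u₀` at `t = 0`. -/
def HasInitialValue {n : ℕ} {s : ℝ} {Ω : Set (Rn n)} {T : ℝ}
    (v : L2Time T (Htilde n s Ω)) (u₀ : L2 n Ω) : Prop :=
  ∃ V : ℝ → L2 n Ω, ContinuousOn V (Icc 0 T) ∧
    (∀ᵐ t ∂(volume.restrict (Ioo 0 T)), V t = restr n s Ω (v t)) ∧ V 0 = u₀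

/-- `u` is a weak solution of `∂_t u + (-Δ)^s u = f + z` in `Ω × (0,T)`, `u = 0` in
`Ωᶜ × (0,T)`, `u(0) = u₀` in `Ω`: one has `u ∈ 𝕍`, `u(0) = u₀` and, for almost every
`t ∈ (0,T)`, `⟨∂_t u, φ⟩ + 𝓐(u, φ) = ⟨f + z, φ⟩` for all `φ ∈ H̃^s(Ω)`. -/
def IsWeakSolution {n : ℕ} {s : ℝ} {Ω : Set (Rn n)} {T : ℝ}
    (f z : L2Time T (Hneg n s Ω)) (u₀ : L2 n Ω) (u : L2Time T (Htilde n s Ω)) : Prop :=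
  u ∈ spaceV n s Ω T ∧ HasInitialValue u u₀ ∧
    ∃ g : L2Time T (Hneg n s Ω), IsTimeDeriv u g ∧
      ∀ᵐ t ∂(volume.restrict (Ioo 0 T)), ∀ φ : Htilde n s Ω,
        g t φ + formA n s (rep (u t)) (rep φ) = (f t + z t) φ

end FracHeat

end

/-! Write `V` for H̃^s(Ω), `H` for L²(Ω), `j` for the restriction `V → H` and `a` for the form 𝓐.
Everything rests on a symmetric, bounded and coercive `a`, and on an injective `j` with dense range.

Existence: a path u = v + ∫₀ᵗ w with w ∈ L²(0,T;V) solves the problem with right-hand side (j w, j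
·) + a(u, ·) and initial value j v. Testing with u gives an energy estimate with constants
independent of T (`energy_estimate`), so the map from data to solution is bounded on the data of
this kind. These data are dense (`denseRange_dataMap`): a functional that annihilates them is
represented by some φ ∈ L²(0,T;V), and the choice w = φ, v = 0 yields ∫ |j φ|² + a(∫₀ᵗ φ, φ) = 0. By
symmetry the second term integrates to half of a(Φ,Φ) with Φ = ∫₀ᵀ φ, which is nonnegative; hence φ
= 0. The solution map therefore extends to all data, and the equation, the initial value and the
bounds survive the limit (`exists_distribSolution`).

Uniqueness: for the difference u of two solutions, integrating the equation in time gives (j u(t), j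
φ) = -a(∫₀ᵗ u, φ). With φ = u(t) this is the same identity as above, so u = 0
(`distribSolution_unique`). No integration by parts for general elements of 𝕍 is needed.

Coercivity: by Plancherel the Gagliardo seminorm is ∫ m(ξ)|𝓕v|² with a symbol m
(`lintegral_diffQuot_eq`). The upper bound m ≤ C(1+|ξ|²)^s makes `a` bounded. The lower bound m ≥
c|ξ|^{2s}, with the Poincaré inequality on bounded Ω (`exists_poincare`), makes it coercive
(`exists_norm_le_gagliardo`). -/

/-! ### Absolute continuity of vector-valued primitives. -/

open Filter Topology in
theorem AbsolutelyContinuousOnInterval.of_dist_le {X Y : Type*} [PseudoMetricSpace X]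
    [PseudoMetricSpace Y] {f : ℝ → X} {g : ℝ → Y} {a b C : ℝ}
    (hg : AbsolutelyContinuousOnInterval g a b)
    (h : ∀ x ∈ uIcc a b, ∀ y ∈ uIcc a b, dist (f x) (f y) ≤ C * dist (g x) (g y)) :
    AbsolutelyContinuousOnInterval f a b := by
  have h1 := Tendsto.const_mul C hg
  rw [mul_zero] at h1
  refine squeeze_zero' (Eventually.of_forall fun E => Finset.sum_nonneg fun _ _ => dist_nonneg)
    ?_ h1
  filter_upwards [mem_inf_of_right (mem_principal_self _)] with E hE
  rw [Finset.mul_sum]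
  exact Finset.sum_le_sum fun i hi => h _ (hE.1 i hi).1 _ (hE.1 i hi).2

theorem IntervalIntegrable.absolutelyContinuousOnInterval_integral {E : Type*}
    [NormedAddCommGroup E] [NormedSpace ℝ E] {w : ℝ → E} {a b : ℝ}
    (hw : IntervalIntegrable w volume a b) :
    AbsolutelyContinuousOnInterval (fun t => ∫ τ in a..t, w τ) a b := by
  have h1 := hw.norm.absolutelyContinuousOnInterval_intervalIntegral (c := a) left_mem_uIcc
  refine h1.of_dist_le (C := 1) fun x hx y hy => ?_
  have hax : IntervalIntegrable w volume a x := hw.mono_set (uIcc_subset_uIcc_left hx)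
  have hay : IntervalIntegrable w volume a y := hw.mono_set (uIcc_subset_uIcc_left hy)
  rw [one_mul, dist_eq_norm, dist_eq_norm,
    intervalIntegral.integral_interval_sub_left hax hay,
    intervalIntegral.integral_interval_sub_left hax.norm hay.norm]
  exact intervalIntegral.norm_integral_le_abs_integral_norm

namespace FracHeat

/-! ### The product rule for a symmetric form along a primitive. -/

section BilinearPrimitive

variable {V : Type*} [NormedAddCommGroup V] [NormedSpace ℝ V]

theorem continuousOn_primitive {w : ℝ → V} {T : ℝ}
    (hw : IntervalIntegrable w volume 0 T) :
    ContinuousOn (fun t => ∫ τ in 0..t, w τ) (uIcc 0 T) :=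
  hw.absolutelyContinuousOnInterval_integral.continuousOn

theorem intervalIntegrable_bilin (B : V →L[ℝ] V →L[ℝ] ℝ) {u w : ℝ → V} {T : ℝ}
    (hu : ContinuousOn u (uIcc 0 T)) (hw : IntervalIntegrable w volume 0 T) :
    IntervalIntegrable (fun t => B (u t) (w t)) volume 0 T := by
  obtain ⟨C, hC⟩ := isCompact_uIcc.exists_bound_of_continuousOn hu
  have hum : AEStronglyMeasurable u (volume.restrict (uIoc 0 T)) :=
    (hu.mono uIoc_subset_uIcc).aestronglyMeasurable measurableSet_uIoc
  rw [intervalIntegrable_iff] at hw ⊢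
  refine Integrable.mono' (hw.norm.const_mul (‖B‖ * C)) ?_ ?_
  · exact B.aestronglyMeasurable_comp₂ hum hw.aestronglyMeasurable
  · filter_upwards [ae_restrict_mem measurableSet_uIoc] with t ht
    calc ‖B (u t) (w t)‖ ≤ ‖B‖ * ‖u t‖ * ‖w t‖ := B.le_opNorm₂ _ _
      _ ≤ ‖B‖ * C * ‖w t‖ := by gcongr; exact hC _ (uIoc_subset_uIcc ht)

/-- The fundamental theorem of calculus for `B (u, u)`, where `u` is a primitive. -/
theorem bilin_primitive [CompleteSpace V] (B : V →L[ℝ] V →L[ℝ] ℝ) (hB : ∀ v w, B v w = B w v) {w : ℝ → V} {T : ℝ}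
    (hw : IntervalIntegrable w volume 0 T) (v₀ : V) :
    B (v₀ + ∫ τ in 0..T, w τ) (v₀ + ∫ τ in 0..T, w τ) =
      B v₀ v₀ + 2 * ∫ t in 0..T, B (v₀ + ∫ τ in 0..t, w τ) (w t) := by
  set u : ℝ → V := fun t => v₀ + ∫ τ in 0..t, w τ with hu
  have huc : ContinuousOn u (uIcc 0 T) := continuousOn_const.add (continuousOn_primitive hw)
  obtain ⟨C, hC⟩ := isCompact_uIcc.exists_bound_of_continuousOn huc
  have hBi := intervalIntegrable_bilin B huc hw
  have h1 : AbsolutelyContinuousOnInterval (fun t => B (u t) (u t)) 0 T := by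
    refine hw.absolutelyContinuousOnInterval_integral.of_dist_le (C := ‖B‖ * (C + C))
      fun x hx y hy => ?_
    have e : B (u x) (u x) - B (u y) (u y) = B (u x + u y) (u x - u y) := by
      simp only [map_add, map_sub, add_apply]
      rw [hB (u y) (u x)]; ring
    have e2 : u x - u y = (∫ τ in 0..x, w τ) - ∫ τ in 0..y, w τ := by simp [hu]
    rw [dist_eq_norm, dist_eq_norm, e, ← e2]
    refine (B.le_opNorm₂ _ _).trans ?_
    gcongr
    exact (norm_add_le _ _).trans (add_le_add (hC x hx) (hC y hy))
  have h2 := hBi.absolutelyContinuousOnInterval_integral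
  -- Both sides are absolutely continuous in the upper limit and have the same derivative almost
  -- everywhere, so their difference is constant; it is then compared at `0` and `T`.
  have h3 := h1.sub (h2.const_mul 2)
  obtain ⟨K, hK⟩ := h3.const_of_ae_hasDerivAt_zero (by
    filter_upwards [hw.ae_hasDerivAt_integral, hBi.ae_hasDerivAt_integral] with t h4 h5 ht
    have h6 : HasDerivAt u (w t) t := (h4 ht 0 left_mem_uIcc).const_add v₀
    have h7 := h5 ht 0 left_mem_uIcc
    have h8 := B.hasFDerivAt_of_bilinear h6.hasFDerivAt h6.hasFDerivAt
    have h9 := h8.hasDerivAt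
    convert! h9.sub (h7.const_mul 2) using 1
    simp [hB (w t) (u t)]
    ring)
  have hT := hK T right_mem_uIcc
  have h0 := hK 0 left_mem_uIcc
  simp only [Pi.sub_apply, hu, intervalIntegral.integral_same, add_zero, mul_zero, sub_zero]
    at hT h0
  linarith

end BilinearPrimitive

/-! ### Distributional derivatives on `(0,T)` of scalar functions. -/

section WeakDerivative

theorem exists_Icc_of_tsupport_subset {η : ℝ → ℝ} {T : ℝ} (hT : 0 < T) (hc : HasCompactSupport η)
    (hs : tsupport η ⊆ Ioo 0 T) : ∃ a b, 0 < a ∧ a ≤ b ∧ b < T ∧ tsupport η ⊆ Icc a b := by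
  rcases (tsupport η).eq_empty_or_nonempty with h | h
  · exact ⟨T / 2, T / 2, by linarith, le_rfl, by linarith, by simp [h]⟩
  · obtain ⟨a, ha⟩ := hc.isCompact.exists_isLeast h
    obtain ⟨b, hb⟩ := hc.isCompact.exists_isGreatest h
    exact ⟨a, b, (hs ha.1).1, ha.2 hb.1, (hs hb.1).2, fun x hx => ⟨ha.2 hx, hb.2 hx⟩⟩

theorem integral_deriv_mul_primitive {q η : ℝ → ℝ} {T : ℝ}
    (hq : IntervalIntegrable q volume 0 T) (hη : ContDiff ℝ ∞ η)
    (hs : tsupport η ⊆ Ioo 0 T) (c : ℝ) :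
    ∫ t in 0..T, deriv η t * (c + ∫ τ in 0..t, q τ) = - ∫ t in 0..T, η t * q t := by
  have h1 : AbsolutelyContinuousOnInterval η 0 T :=
    (hη.of_le (by norm_cast)).contDiffOn.absolutelyContinuousOnInterval
  have h2 : AbsolutelyContinuousOnInterval (fun t => c + ∫ τ in 0..t, q τ) 0 T :=
    hq.absolutelyContinuousOnInterval_integral.of_dist_le (C := 1) (by simp)
  have h3 := h1.integral_mul_deriv_eq_deriv_mul h2
  have h0 : η 0 = 0 := image_eq_zero_of_notMem_tsupport fun h => lt_irrefl _ (hs h).1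
  have hT0 : η T = 0 := image_eq_zero_of_notMem_tsupport fun h => lt_irrefl _ (hs h).2
  rw [h0, hT0, zero_mul, zero_mul, sub_zero, zero_sub] at h3
  rw [eq_neg_iff_add_eq_zero, add_comm, ← eq_neg_iff_add_eq_zero, ← h3]
  refine intervalIntegral.integral_congr_ae ?_
  filter_upwards [hq.ae_hasDerivAt_integral] with t ht ht'
  rw [((ht (uIoc_subset_uIcc ht') 0 left_mem_uIcc).const_add c).deriv]

/-- A smooth function of zero integral with compact support in `(0,T)` is the derivative of such
a function. -/
theorem exists_primitive_of_integral_eq_zero {θ : ℝ → ℝ} {T : ℝ} (hT : 0 < T)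
    (hθ : ContDiff ℝ ∞ θ) (hc : HasCompactSupport θ) (hs : tsupport θ ⊆ Ioo 0 T)
    (h0 : ∫ t in 0..T, θ t = 0) :
    ∃ η : ℝ → ℝ, ContDiff ℝ ∞ η ∧ HasCompactSupport η ∧ tsupport η ⊆ Ioo 0 T ∧ deriv η = θ := by
  obtain ⟨a, b, ha, -, hb, hab⟩ := exists_Icc_of_tsupport_subset hT hc hs
  have hd : ∀ t, HasDerivAt (fun t => ∫ τ in 0..t, θ τ) (θ t) t := fun t =>
    intervalIntegral.integral_hasDerivAt_right (hθ.continuous.intervalIntegrable _ _)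
      hθ.continuous.aestronglyMeasurable.stronglyMeasurableAtFilter hθ.continuous.continuousAt
  have hderiv : deriv (fun t => ∫ τ in 0..t, θ τ) = θ := funext fun t => (hd t).deriv
  have hz : ∀ t, t ∉ Icc a b → θ t = 0 := fun t ht =>
    image_eq_zero_of_notMem_tsupport fun h => ht (hab h)
  -- Left of `a` nothing has been integrated yet; right of `b` the primitive equals the total
  -- integral, which is zero.
  have hsupp : tsupport (fun t => ∫ τ in 0..t, θ τ) ⊆ Icc a b := by
    refine closure_minimal (fun t ht => ?_) isClosed_Icc
    by_contra hn
    refine ht ?_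
    rcases lt_or_ge t a with h | h
    · refine intervalIntegral.integral_zero_ae (Filter.Eventually.of_forall fun τ hτ => hz τ ?_)
      intro h'
      rcases le_total 0 t with h2 | h2
      · rw [uIoc_of_le h2] at hτ; linarith [hτ.2, h'.1]
      · rw [uIoc_of_ge h2] at hτ; linarith [hτ.2, h'.1]
    · have hbt : b < t := by
        by_contra h2
        exact hn ⟨h, not_lt.1 h2⟩
      have e : ∫ τ in T..t, θ τ = 0 := by
        refine intervalIntegral.integral_zero_ae (Filter.Eventually.of_forall fun τ hτ => hz τ ?_)
        intro h'
        rcases le_total T t with h2 | h2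
        · rw [uIoc_of_le h2] at hτ; linarith [hτ.1, h'.2]
        · rw [uIoc_of_ge h2] at hτ; linarith [hτ.1, h'.2]
      have := intervalIntegral.integral_add_adjacent_intervals
        (hθ.continuous.intervalIntegrable (μ := volume) 0 T) (hθ.continuous.intervalIntegrable T t)
      simpa [h0, e] using this.symm
  refine ⟨_, ?_, HasCompactSupport.of_support_subset_isCompact isCompact_Icc
    (subset_closure.trans hsupp), hsupp.trans fun t ht => ⟨by linarith [ht.1], by linarith [ht.2]⟩,
    hderiv⟩
  rw [contDiff_infty_iff_deriv, hderiv]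
  exact ⟨fun t => (hd t).differentiableAt, hθ⟩

/-- A continuous function on `[0,T]` whose distributional derivative vanishes is constant. -/
theorem eq_of_integral_deriv_mul_eq_zero {z : ℝ → ℝ} {T : ℝ} (hT : 0 < T)
    (hz : ContinuousOn z (Icc 0 T))
    (h : ∀ η : ℝ → ℝ, ContDiff ℝ ∞ η → HasCompactSupport η → tsupport η ⊆ Ioo 0 T →
      ∫ t in 0..T, deriv η t * z t = 0) :
    ∀ t ∈ Icc 0 T, z t = z 0 := by
  have hzu : ContinuousOn z (uIcc 0 T) := by rwa [uIcc_of_le hT.le]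
  obtain ⟨χ, hχs, hχc, hχd, hχr, hχ1⟩ :=
    exists_contDiff_tsupport_subset (n := ⊤) (Ioo_mem_nhds (show 0 < T / 2 by linarith)
      (show T / 2 < T by linarith))
  have hχpos : 0 < ∫ t in 0..T, χ t := by
    refine intervalIntegral.integral_pos hT hχd.continuous.continuousOn
      (fun t _ => (hχr (mem_range_self t)).1) ⟨T / 2, ⟨by linarith, by linarith⟩, ?_⟩
    rw [hχ1]; exact one_pos
  set I := ∫ t in 0..T, χ t with hI
  set c := I⁻¹ * ∫ t in 0..T, χ t * z t with hcdef
  -- Du Bois-Reymond: subtracting the multiple `J * I⁻¹` of the bump `χ` from a test function `ψ`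
  -- gives it zero mean, hence makes it a derivative that the hypothesis annihilates. The constant
  -- `c` is the `χ`-weighted mean of `z`.
  have key : ∀ᵐ t, t ∈ Ioo 0 T → z t - c = 0 := by
    refine isOpen_Ioo.ae_eq_zero_of_integral_contDiff_smul_eq_zero ?_ ?_
    · exact ((hz.mono Ioo_subset_Icc_self).sub continuousOn_const).locallyIntegrableOn
        measurableSet_Ioo
    · intro ψ hψ hψc hψs
      have hint : ∫ t, ψ t • (z t - c) = ∫ t in 0..T, ψ t * (z t - c) := by
        rw [intervalIntegral.integral_of_le hT.le]
        refine (setIntegral_eq_integral_of_forall_compl_eq_zero fun t ht => ?_).symm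
        have : t ∉ tsupport ψ := fun h => ht (Ioo_subset_Ioc_self (hψs h))
        simp [image_eq_zero_of_notMem_tsupport this]
      set J := ∫ t in 0..T, ψ t
      have iψ : IntervalIntegrable ψ volume 0 T := hψ.continuous.intervalIntegrable _ _
      have iχ : IntervalIntegrable χ volume 0 T := hχd.continuous.intervalIntegrable _ _
      have iψz : IntervalIntegrable (fun t => ψ t * z t) volume 0 T :=
        (hψ.continuous.continuousOn.mul hzu).intervalIntegrable
      have iχz : IntervalIntegrable (fun t => χ t * z t) volume 0 T :=
        (hχd.continuous.continuousOn.mul hzu).intervalIntegrable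
      obtain ⟨η, h1, h2, h3, h4⟩ := exists_primitive_of_integral_eq_zero
        (θ := fun t => ψ t - J * I⁻¹ * χ t) hT (hψ.sub (contDiff_const.mul hχd))
        (hψc.sub (hχc.mul_left (f := fun _ => J * I⁻¹)))
        ((tsupport_sub _ _).trans (union_subset hψs
          ((closure_mono (Function.support_mul_subset_right _ _)).trans hχs))) (by
          rw [intervalIntegral.integral_sub iψ (iχ.const_mul _),
            intervalIntegral.integral_const_mul]
          change J - J * I⁻¹ * I = 0
          rw [mul_assoc, inv_mul_cancel₀ hχpos.ne', mul_one, sub_self])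
      have h5 := h η h1 h2 h3
      rw [h4] at h5
      have e1 : ∀ t, (ψ t - J * I⁻¹ * χ t) * z t = ψ t * z t - J * I⁻¹ * (χ t * z t) :=
        fun t => by ring
      simp only [e1] at h5
      rw [intervalIntegral.integral_sub iψz (iχz.const_mul _),
        intervalIntegral.integral_const_mul] at h5
      have e2 : ∀ t, ψ t * (z t - c) = ψ t * z t - ψ t * c := fun t => by ring
      rw [hint]
      simp only [e2]
      rw [intervalIntegral.integral_sub iψz (iψ.mul_const _), intervalIntegral.integral_mul_const,
        hcdef]
      linear_combination h5
  have hc : EqOn z (fun _ => c) (Icc 0 T) := by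
    refine Measure.eqOn_Icc_of_ae_eq volume hT.ne ?_ hz continuousOn_const
    rw [Filter.EventuallyEq, ae_restrict_congr_set Ioo_ae_eq_Icc.symm,
      ae_restrict_iff' measurableSet_Ioo]
    filter_upwards [key] with t ht hm
    linarith [ht hm]
  intro t ht
  rw [hc ht, hc (left_mem_Icc.2 hT.le)]

/-- A continuous function on `[0,T]` with the distributional derivative `q` is a primitive of
`q`. -/
theorem eq_add_integral_of_integral_deriv_mul {y q : ℝ → ℝ} {T : ℝ} (hT : 0 < T)
    (hy : ContinuousOn y (Icc 0 T)) (hq : IntervalIntegrable q volume 0 T)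
    (h : ∀ η : ℝ → ℝ, ContDiff ℝ ∞ η → HasCompactSupport η → tsupport η ⊆ Ioo 0 T →
      ∫ t in 0..T, deriv η t * y t = - ∫ t in 0..T, η t * q t) :
    ∀ t ∈ Icc 0 T, y t = y 0 + ∫ τ in 0..t, q τ := by
  have hp : ContinuousOn (fun t => ∫ τ in 0..t, q τ) (Icc 0 T) := by
    simpa only [uIcc_of_le hT.le] using continuousOn_primitive hq
  have h1 := eq_of_integral_deriv_mul_eq_zero (z := fun t => y t - ∫ τ in 0..t, q τ) hT
    (hy.sub hp) fun η h1 h2 h3 => ?_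
  · intro t ht
    have h2 := h1 t ht
    simp only [intervalIntegral.integral_same, sub_zero] at h2
    linarith
  · have h4 := h η h1 h2 h3
    have h5 := integral_deriv_mul_primitive hq h1 h3 0
    have hd : Continuous (deriv η) := (contDiff_infty_iff_deriv.1 h1).2.continuous
    simp only [mul_sub, zero_add] at h5 ⊢
    rw [intervalIntegral.integral_sub, h4, h5, sub_self]
    · exact ((hd.continuousOn.mul hy).mono (uIcc_of_le hT.le).subset).intervalIntegrable
    · exact ((hd.continuousOn.mul hp).mono (uIcc_of_le hT.le).subset).intervalIntegrable
end WeakDerivative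

/-! ### Bochner spaces in time and a density criterion. -/

section TimeSpaces

variable {X : Type} [NormedAddCommGroup X] {T : ℝ}

theorem L2Time.integrable_norm_sq (f : L2Time T X) :
    Integrable (fun t => ‖f t‖ ^ 2) (volume.restrict (Ioo 0 T)) :=
  (Lp.memLp f).norm.integrable_sq

theorem L2Time.norm_sq (f : L2Time T X) : ‖f‖ ^ 2 = ∫ t in Ioo 0 T, ‖f t‖ ^ 2 := by
  have h := (Lp.memLp f).eLpNorm_eq_integral_rpow_norm (by norm_num) (by norm_num)
  have h0 : 0 ≤ ∫ t in Ioo 0 T, ‖f t‖ ^ 2 := integral_nonneg fun t => by positivity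
  rw [Lp.norm_def, h, ENNReal.toReal_ofReal (by positivity)]
  simp only [ENNReal.toReal_ofNat, Real.rpow_ofNat]
  rw [← Real.rpow_natCast, ← Real.rpow_mul h0]
  norm_num

theorem L2Time.intervalIntegrable (f : L2Time T X) (hT : 0 ≤ T) :
    IntervalIntegrable f volume 0 T := by
  rw [intervalIntegrable_iff_integrableOn_Ioo_of_le hT]
  exact (Lp.memLp f).integrable one_le_two

theorem intervalIntegral_eq_Ioo [NormedSpace ℝ X] (f : ℝ → X) (hT : 0 ≤ T) :
    ∫ t in 0..T, f t = ∫ t in Ioo 0 T, f t := by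
  rw [intervalIntegral.integral_of_le hT, integral_Ioc_eq_integral_Ioo]

theorem ae_Ioc_of_ae_Ioo {p : ℝ → Prop} (h : ∀ᵐ t ∂(volume.restrict (Ioo 0 T)), p t) {S : ℝ}
    (hS : S ∈ Icc 0 T) : ∀ᵐ t, t ∈ uIoc 0 S → p t := by
  rw [ae_restrict_congr_set Ioo_ae_eq_Ioc, ae_restrict_iff' measurableSet_Ioc] at h
  filter_upwards [h] with t ht h'
  rw [uIoc_of_le hS.1] at h'
  exact ht ⟨h'.1, h'.2.trans hS.2⟩

/-- The integral is an `L²` inner product with `k`. This continuity lets the weak formulation pass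
to limits of data. -/
theorem continuous_integral_mul [NormedSpace ℝ X] {k : ℝ → ℝ}
    (hk : MemLp k 2 (volume.restrict (Ioo 0 T))) (ℓ : X →L[ℝ] ℝ) :
    Continuous fun f : L2Time T X => ∫ t in Ioo 0 T, k t * ℓ (f t) := by
  have h : (fun f : L2Time T X => ∫ t in Ioo 0 T, k t * ℓ (f t)) =
      fun f => inner ℝ (hk.toLp k) (ℓ.compLpL 2 (volume.restrict (Ioo 0 T)) f) := by
    ext f
    rw [L2.inner_def]
    refine integral_congr_ae ?_
    filter_upwards [hk.coeFn_toLp, ℓ.coeFn_compLpL (p := 2) f] with t h1 h2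
    rw [h1, h2]
    simp [mul_comm]
  rw [h]
  exact continuous_const.inner (ContinuousLinearMap.continuous _)

theorem dense_of_forall_dual {E : Type*} [NormedAddCommGroup E] [NormedSpace ℝ E]
    (p : Submodule ℝ E) (h : ∀ ℓ : StrongDual ℝ E, (∀ y ∈ p, ℓ y = 0) → ℓ = 0) :
    Dense (p : Set E) := by
  by_contra hd
  obtain ⟨x, hx⟩ : ∃ x, x ∉ closure (p : Set E) := by
    by_contra! h'
    exact hd h'
  obtain ⟨f, u, h1, h2⟩ := geometric_hahn_banach_point_closed (p.convex.closure)
    isClosed_closure hx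
  have h0 : ∀ y ∈ p, f y = 0 := by
    intro y hy
    by_contra hne
    -- A functional bounded below by `u` on a subspace vanishes there: otherwise some multiple of
    -- `y` takes the value `u - 1`.
    have h3 := h2 _ (subset_closure (p.smul_mem ((u - 1) / f y) hy))
    rw [map_smul, smul_eq_mul, div_mul_cancel₀ _ hne] at h3
    linarith
  have h3 := h2 0 (subset_closure p.zero_mem)
  rw [h f h0] at h1 h3
  simp only [zero_apply] at h1 h3
  linarith

end TimeSpaces

/-! ### The abstract parabolic problem: existence, estimates and uniqueness. -/

section Parabolic

variable {V H : Type} [NormedAddCommGroup V] [InnerProductSpace ℝ V] [CompleteSpace V]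
  [NormedAddCommGroup H] [InnerProductSpace ℝ H]

/-- The bilinear form `(v, w) ↦ (j v, j w)`. -/
noncomputable def pullInner (j : V →L[ℝ] H) : V →L[ℝ] V →L[ℝ] ℝ := (innerSL ℝ).bilinearComp j j

omit [CompleteSpace V] in
@[simp] theorem pullInner_apply (j : V →L[ℝ] H) (v w : V) :
    pullInner j v w = inner ℝ (j v) (j w) := rfl

/-- The path `t ↦ v + ∫_0^t w`, continued by constants outside `[0,T]`. -/
noncomputable def path {T : ℝ} (hT : 0 ≤ T) :
    (L2Time T V × V) →ₗ[ℝ] BoundedContinuousFunction ℝ V where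
  toFun x := (BoundedContinuousFunction.mkOfCompact
    ⟨fun t : Icc 0 T => x.2 + ∫ τ in 0..(t : ℝ), x.1 τ, by
      have h := continuousOn_primitive (x.1.intervalIntegrable hT)
      rw [uIcc_of_le hT] at h
      exact continuous_const.add (continuousOn_iff_continuous_domRestrict.1 h)⟩).compContinuous
    ⟨projIcc 0 T hT, continuous_projIcc⟩
  map_add' x y := by
    ext t
    have hs : IntervalIntegrable x.1 volume 0 (projIcc 0 T hT t : ℝ) :=
      (x.1.intervalIntegrable hT).mono_set (uIcc_subset_uIcc_left
        (Icc_subset_uIcc (projIcc 0 T hT t).2))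
    have hs' : IntervalIntegrable y.1 volume 0 (projIcc 0 T hT t : ℝ) :=
      (y.1.intervalIntegrable hT).mono_set (uIcc_subset_uIcc_left
        (Icc_subset_uIcc (projIcc 0 T hT t).2))
    change (x.2 + y.2) + ∫ τ in 0..(projIcc 0 T hT t : ℝ), (x.1 + y.1) τ =
      (x.2 + ∫ τ in 0..(projIcc 0 T hT t : ℝ), x.1 τ) +
        (y.2 + ∫ τ in 0..(projIcc 0 T hT t : ℝ), y.1 τ)
    rw [add_add_add_comm, ← intervalIntegral.integral_add hs hs']
    congr 1
    exact intervalIntegral.integral_congr_ae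
      (ae_Ioc_of_ae_Ioo (Lp.coeFn_add x.1 y.1) (projIcc 0 T hT t).2)
  map_smul' c x := by
    ext t
    change c • x.2 + ∫ τ in 0..(projIcc 0 T hT t : ℝ), (c • x.1) τ =
      c • (x.2 + ∫ τ in 0..(projIcc 0 T hT t : ℝ), x.1 τ)
    rw [smul_add, ← intervalIntegral.integral_smul]
    congr 1
    exact intervalIntegral.integral_congr_ae
      (ae_Ioc_of_ae_Ioo (Lp.coeFn_smul c x.1) (projIcc 0 T hT t).2)

omit [CompleteSpace V] in
theorem path_apply {T : ℝ} (hT : 0 ≤ T) (x : L2Time T V × V) {t : ℝ} (ht : t ∈ Icc 0 T) :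
    path hT x t = x.2 + ∫ τ in 0..t, x.1 τ := by
  change x.2 + ∫ τ in 0..(projIcc 0 T hT t : ℝ), x.1 τ = _
  rw [projIcc_of_mem hT ht]

omit [CompleteSpace V] in
theorem exists_path_eq {T : ℝ} (hT : 0 ≤ T) (x : L2Time T V × V) (t : ℝ) :
    ∃ s ∈ Icc 0 T, path hT x t = path hT x s := by
  refine ⟨projIcc 0 T hT t, (projIcc 0 T hT t).2, ?_⟩
  rw [path_apply hT x (projIcc 0 T hT t).2]
  rfl

/-- The path `t ↦ v + ∫_0^t w` as an element of `L²(0,T;V)`. -/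
noncomputable def pathLp {T : ℝ} (hT : 0 ≤ T) : (L2Time T V × V) →ₗ[ℝ] L2Time T V :=
  (BoundedContinuousFunction.toLp 2 (volume.restrict (Ioo 0 T)) ℝ).toLinearMap ∘ₗ path hT

omit [CompleteSpace V] in
theorem coeFn_pathLp {T : ℝ} (hT : 0 ≤ T) (x : L2Time T V × V) :
    ∀ᵐ t ∂(volume.restrict (Ioo 0 T)), pathLp hT x t = x.2 + ∫ τ in 0..t, x.1 τ := by
  filter_upwards [BoundedContinuousFunction.coeFn_toLp 2 (volume.restrict (Ioo 0 T)) ℝ (path hT x),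
    ae_restrict_mem measurableSet_Ioo] with t h1 h2
  rw [← path_apply hT x (Ioo_subset_Icc_self h2)]
  exact h1

/-- The data of the parabolic problem that is solved by `u = v + ∫_0^· w`: the right-hand side
`(j w, j ·) + a (u, ·)` and the initial value `j v`. -/
noncomputable def dataMap (j : V →L[ℝ] H) (a : V →L[ℝ] V →L[ℝ] ℝ) {T : ℝ} (hT : 0 ≤ T) :
    (L2Time T V × V) →ₗ[ℝ] L2Time T (StrongDual ℝ V) × H :=
  LinearMap.prod
    (((pullInner j).compLpL 2 (volume.restrict (Ioo 0 T))).toLinearMap ∘ₗ LinearMap.fst ℝ _ _ +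
      (a.compLpL 2 (volume.restrict (Ioo 0 T))).toLinearMap ∘ₗ pathLp hT)
    (j.toLinearMap ∘ₗ LinearMap.snd ℝ _ _)

omit [CompleteSpace V] in
theorem coeFn_dataMap_fst (j : V →L[ℝ] H) (a : V →L[ℝ] V →L[ℝ] ℝ) {T : ℝ} (hT : 0 ≤ T)
    (x : L2Time T V × V) :
    ∀ᵐ t ∂(volume.restrict (Ioo 0 T)),
      (dataMap j a hT x).1 t = pullInner j (x.1 t) + a (x.2 + ∫ τ in 0..t, x.1 τ) := by
  filter_upwards [coeFn_pathLp hT x, (pullInner j).coeFn_compLpL (p := 2) x.1,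
    a.coeFn_compLpL (p := 2) (pathLp hT x),
    Lp.coeFn_add ((pullInner j).compLpL 2 (volume.restrict (Ioo 0 T)) x.1)
      (a.compLpL 2 (volume.restrict (Ioo 0 T)) (pathLp hT x))] with t h1 h2 h3 h4
  rw [← h1, ← h2, ← h3]
  exact h4

/-- The solution map on the data in the range of `dataMap`, with values in
`L²(0,T;V)` and in the continuous functions with values in `H`. -/
noncomputable def pathPair (j : V →L[ℝ] H) {T : ℝ} (hT : 0 ≤ T) :
    (L2Time T V × V) →ₗ[ℝ] L2Time T V × BoundedContinuousFunction ℝ H :=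
  LinearMap.prod (pathLp hT) ((j.compLeftContinuousBounded ℝ).toLinearMap ∘ₗ path hT)

/-- Testing with u itself: the derivative of |j u|² is 2F(u) - 2a(u,u). Coercivity bounds the last
term by -2α‖u‖², and Young's inequality spends half of this on absorbing 2F(u). -/
theorem energy_estimate (j : V →L[ℝ] H) (a : V →L[ℝ] V →L[ℝ] ℝ) {α : ℝ} (hα : 0 < α)
    (hco : ∀ v, α * ‖v‖ ^ 2 ≤ a v v) {T : ℝ} (hT : 0 ≤ T) (x : L2Time T V × V) {t : ℝ}
    (ht : t ∈ Icc 0 T) :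
    ‖j (path hT x t)‖ ^ 2 + α * ∫ τ in 0..t, ‖path hT x τ‖ ^ 2 ≤
      ‖(dataMap j a hT x).2‖ ^ 2 + α⁻¹ * ‖(dataMap j a hT x).1‖ ^ 2 := by
  set F := (dataMap j a hT x).1 with hF
  have hsub : uIcc 0 t ⊆ uIcc 0 T := uIcc_subset_uIcc_left (Icc_subset_uIcc ht)
  have hw : IntervalIntegrable x.1 volume 0 t := (x.1.intervalIntegrable hT).mono_set hsub
  set u : ℝ → V := fun t => x.2 + ∫ τ in 0..t, x.1 τ with hu
  have hpu : ∀ τ ∈ Icc 0 T, path hT x τ = u τ := fun τ hτ => path_apply hT x hτ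
  have huc : ContinuousOn u (uIcc 0 t) := continuousOn_const.add (continuousOn_primitive hw)
  have h1 := bilin_primitive (pullInner j) (fun v w => real_inner_comm _ _) hw x.2
  have hFi : IntervalIntegrable (fun τ => ‖F τ‖ ^ 2) volume 0 t := by
    have := (intervalIntegrable_iff_integrableOn_Ioo_of_le hT).2 F.integrable_norm_sq
    exact this.mono_set hsub
  have hui : IntervalIntegrable (fun τ => ‖u τ‖ ^ 2) volume 0 t :=
    (huc.norm.pow 2).intervalIntegrable
  have h2 : 2 * ∫ τ in 0..t, pullInner j (u τ) (x.1 τ) ≤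
      ∫ τ in 0..t, (α⁻¹ * ‖F τ‖ ^ 2 - α * ‖u τ‖ ^ 2) := by
    rw [← intervalIntegral.integral_const_mul]
    refine intervalIntegral.integral_mono_ae_restrict ht.1
      ((intervalIntegrable_bilin _ huc hw).const_mul 2)
      ((hFi.const_mul _).sub (hui.const_mul _)) ?_
    have h3 := ae_Ioc_of_ae_Ioo (coeFn_dataMap_fst j a hT x) ht
    rw [uIoc_of_le ht.1] at h3
    rw [Filter.EventuallyLE, ae_restrict_congr_set Ioc_ae_eq_Icc.symm,
      ae_restrict_iff' measurableSet_Ioc]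
    filter_upwards [h3] with τ h4 hτ
    have h5 : F τ (u τ) = pullInner j (u τ) (x.1 τ) + a (u τ) (u τ) := by
      rw [hF, h4 hτ, add_apply, pullInner_apply, pullInner_apply, real_inner_comm]
    have h6 : F τ (u τ) ≤ ‖F τ‖ * ‖u τ‖ := (le_abs_self _).trans ((F τ).le_opNorm _)
    have h7 := hco (u τ)
    -- Young's inequality in the form of a completed square.
    have h8 : α⁻¹ * ‖F τ‖ ^ 2 - 2 * (‖F τ‖ * ‖u τ‖) + α * ‖u τ‖ ^ 2 =
        α⁻¹ * (‖F τ‖ - α * ‖u τ‖) ^ 2 := by field_simp; ring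
    have h9 : 0 ≤ α⁻¹ * (‖F τ‖ - α * ‖u τ‖) ^ 2 := by positivity
    linarith
  rw [intervalIntegral.integral_sub (hFi.const_mul _) (hui.const_mul _),
    intervalIntegral.integral_const_mul, intervalIntegral.integral_const_mul] at h2
  have h3 : ∫ τ in 0..t, ‖F τ‖ ^ 2 ≤ ‖F‖ ^ 2 := by
    rw [F.norm_sq, ← intervalIntegral_eq_Ioo _ hT]
    refine intervalIntegral.integral_mono_interval le_rfl ht.1 ht.2
      (Filter.Eventually.of_forall fun τ => by positivity) ?_
    exact (intervalIntegrable_iff_integrableOn_Ioo_of_le hT).2 F.integrable_norm_sq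
  have h4 : ∫ τ in 0..t, ‖path hT x τ‖ ^ 2 = ∫ τ in 0..t, ‖u τ‖ ^ 2 := by
    refine intervalIntegral.integral_congr fun τ hτ => ?_
    have : τ ∈ Icc 0 T := by
      have := hsub hτ
      rwa [uIcc_of_le hT] at this
    simp only [hpu τ this]
  have h5 : (dataMap j a hT x).2 = j x.2 := rfl
  rw [h4, hpu t ht, h5]
  simp only [pullInner_apply, real_inner_self_eq_norm_sq] at h1
  have h6 : α⁻¹ * ∫ τ in 0..t, ‖F τ‖ ^ 2 ≤ α⁻¹ * ‖F‖ ^ 2 := by gcongr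
  simp only [pullInner_apply] at h2
  change ‖j (u t)‖ ^ 2 = _ at h1
  linarith

theorem norm_path_sq_le (j : V →L[ℝ] H) (a : V →L[ℝ] V →L[ℝ] ℝ) {α : ℝ} (hα : 0 < α)
    (hco : ∀ v, α * ‖v‖ ^ 2 ≤ a v v) {T : ℝ} (hT : 0 ≤ T) (x : L2Time T V × V) (t : ℝ) :
    ‖j (path hT x t)‖ ^ 2 ≤
      ‖(dataMap j a hT x).2‖ ^ 2 + α⁻¹ * ‖(dataMap j a hT x).1‖ ^ 2 := by
  obtain ⟨s, hs, h⟩ := exists_path_eq hT x t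
  rw [h]
  refine le_trans (le_add_of_nonneg_right ?_) (energy_estimate j a hα hco hT x hs)
  exact mul_nonneg hα.le (intervalIntegral.integral_nonneg hs.1 fun τ _ => by positivity)

theorem norm_pathLp_sq_le (j : V →L[ℝ] H) (a : V →L[ℝ] V →L[ℝ] ℝ) {α : ℝ} (hα : 0 < α)
    (hco : ∀ v, α * ‖v‖ ^ 2 ≤ a v v) {T : ℝ} (hT : 0 ≤ T) (x : L2Time T V × V) :
    α * ‖pathLp hT x‖ ^ 2 ≤
      ‖(dataMap j a hT x).2‖ ^ 2 + α⁻¹ * ‖(dataMap j a hT x).1‖ ^ 2 := by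
  have h : ‖pathLp hT x‖ ^ 2 = ∫ τ in 0..T, ‖path hT x τ‖ ^ 2 := by
    rw [L2Time.norm_sq, intervalIntegral_eq_Ioo _ hT]
    refine integral_congr_ae ?_
    filter_upwards [BoundedContinuousFunction.coeFn_toLp 2 (volume.restrict (Ioo 0 T)) ℝ
      (path hT x)] with t ht
    rw [← ht]
    rfl
  rw [h]
  exact le_trans (le_add_of_nonneg_left (by positivity))
    (energy_estimate j a hα hco hT x (right_mem_Icc.2 hT))

/-- A function `φ ∈ L²(0,T;V)` vanishes if `∫ |j φ|² + a (∫_0^· φ, φ) ≤ 0`. -/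
theorem ae_eq_zero_of_integral_primitive_nonpos (j : V →L[ℝ] H) (hj : Function.Injective j)
    (a : V →L[ℝ] V →L[ℝ] ℝ) (hsymm : ∀ v w, a v w = a w v) (hnn : ∀ v, 0 ≤ a v v) {T : ℝ}
    (hT : 0 ≤ T) (φ : L2Time T V)
    (h : ∫ t in Ioo 0 T, (‖j (φ t)‖ ^ 2 + a (∫ τ in 0..t, φ τ) (φ t)) ≤ 0) : φ = 0 := by
  have hφ := φ.intervalIntegrable hT
  -- Symmetry makes the second term of the integrand half of a derivative; its integral is half of
  -- `a` at the endpoint primitive, hence nonnegative.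
  have h1 := bilin_primitive a hsymm hφ 0
  simp only [zero_add, map_zero] at h1
  have hi : Integrable (fun t => a (∫ τ in 0..t, φ τ) (φ t)) (volume.restrict (Ioo 0 T)) :=
    (intervalIntegrable_iff_integrableOn_Ioo_of_le hT).1
      (intervalIntegrable_bilin a (continuousOn_primitive hφ) hφ)
  have hjφ : ∀ᵐ t ∂(volume.restrict (Ioo 0 T)),
      j.compLpL 2 (volume.restrict (Ioo 0 T)) φ t = j (φ t) := j.coeFn_compLpL φ
  have hn : ∫ t in Ioo 0 T, ‖j (φ t)‖ ^ 2 =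
      ‖j.compLpL 2 (volume.restrict (Ioo 0 T)) φ‖ ^ 2 := by
    rw [L2Time.norm_sq]
    exact integral_congr_ae (hjφ.mono fun t ht => by simp only [ht])
  have hi2 : Integrable (fun t => ‖j (φ t)‖ ^ 2) (volume.restrict (Ioo 0 T)) :=
    (L2Time.integrable_norm_sq (j.compLpL 2 (volume.restrict (Ioo 0 T)) φ)).congr (hjφ.mono fun t ht => by simp only [ht])
  rw [integral_add hi2 hi, hn, ← intervalIntegral_eq_Ioo _ hT] at h
  have h2 := hnn (∫ τ in 0..T, φ τ)
  have h3 : ‖j.compLpL 2 (volume.restrict (Ioo 0 T)) φ‖ ^ 2 ≤ 0 := by linarith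
  have h4 : j.compLpL 2 (volume.restrict (Ioo 0 T)) φ = 0 := by
    rw [← norm_eq_zero]
    exact pow_eq_zero_iff two_ne_zero |>.1 (le_antisymm h3 (by positivity))
  rw [Lp.eq_zero_iff_ae_eq_zero] at h4 ⊢
  filter_upwards [h4, hjφ] with t h5 h6
  rw [h5] at h6
  exact hj (by simpa using h6.symm)

/-- By Hahn–Banach, a functional vanishing on the range has to be zero. Its first component is
represented by some `φ`, and the data of the path with velocity `φ` and initial value `0` force `φ =
0`. Its second component then vanishes on the dense range of `j`. -/
theorem denseRange_dataMap (j : V →L[ℝ] H) (hj : Function.Injective j) (hjd : DenseRange j)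
    (a : V →L[ℝ] V →L[ℝ] ℝ) (hsymm : ∀ v w, a v w = a w v) (hnn : ∀ v, 0 ≤ a v v) {T : ℝ}
    (hT : 0 ≤ T) : DenseRange (dataMap j a hT) := by
  refine dense_of_forall_dual (LinearMap.range (dataMap j a hT)) fun ℓ hℓ => ?_
  set μ := volume.restrict (Ioo 0 T) with hμ
  set ℓ₁ : L2Time T (StrongDual ℝ V) →L[ℝ] ℝ := ℓ ∘L ContinuousLinearMap.inl ℝ _ _ with hℓ₁
  set ℓ₂ : H →L[ℝ] ℝ := ℓ ∘L ContinuousLinearMap.inr ℝ _ _ with hℓ₂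
  have hsplit : ∀ y, ℓ y = ℓ₁ y.1 + ℓ₂ y.2 := fun y => by
    simp [hℓ₁, hℓ₂, ← map_add]
  -- The dual of L²(0,T;V') is reached through Hilbert spaces: the functional is pulled back to
  -- L²(0,T;V) along the Riesz map of `V`, and represented there by Riesz again.
  set φ : L2Time T V :=
    (InnerProductSpace.toDual ℝ _).symm (ℓ₁ ∘L (innerSL ℝ : V →L[ℝ] V →L[ℝ] ℝ).compLpL 2 μ)
    with hφ
  have hrepr : ∀ G : L2Time T (StrongDual ℝ V), ℓ₁ G = ∫ t in Ioo 0 T, G t (φ t) := by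
    intro G
    set K := (InnerProductSpace.toDual ℝ V).symm.toContinuousLinearEquiv.toContinuousLinearMap
    have h1 : (innerSL ℝ : V →L[ℝ] V →L[ℝ] ℝ).compLpL 2 μ (K.compLpL 2 μ G) = G := by
      refine Lp.ext ?_
      filter_upwards [(innerSL ℝ : V →L[ℝ] V →L[ℝ] ℝ).coeFn_compLpL (p := 2) (K.compLpL 2 μ G),
        K.coeFn_compLpL (p := 2) G] with t h2 h3
      rw [h2, h3]
      ext v
      exact InnerProductSpace.toDual_symm_apply
    have h2 : inner ℝ φ (K.compLpL 2 μ G) = ℓ₁ G := by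
      rw [hφ, InnerProductSpace.toDual_symm_apply, ContinuousLinearMap.comp_apply, h1]
    rw [← h2, L2.inner_def]
    refine integral_congr_ae ?_
    filter_upwards [K.coeFn_compLpL (p := 2) G] with t h3
    rw [h3, real_inner_comm]
    exact InnerProductSpace.toDual_symm_apply
  have hφ0 : φ = 0 := by
    refine ae_eq_zero_of_integral_primitive_nonpos j hj a hsymm hnn hT φ (le_of_eq ?_)
    have h1 := hℓ _ (LinearMap.mem_range_self (dataMap j a hT) (φ, 0))
    have h2 : (dataMap j a hT (φ, 0)).2 = 0 := map_zero j
    rw [hsplit, h2, map_zero, add_zero, hrepr] at h1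
    refine Eq.trans (integral_congr_ae ?_) h1
    filter_upwards [coeFn_dataMap_fst j a hT (φ, 0)] with t ht
    rw [ht]
    simp
  have hℓ₁0 : ℓ₁ = 0 := by
    ext G
    rw [hrepr, hφ0]
    refine (integral_congr_ae ?_).trans (integral_zero _ _)
    filter_upwards [Lp.coeFn_zero V 2 μ] with t ht
    change G t ((0 : Lp V 2 μ) t) = 0
    rw [ht]
    exact map_zero _
  have hℓ₂0 : ∀ h, ℓ₂ h = 0 := by
    refine fun h => hjd.induction_on h (isClosed_eq ℓ₂.continuous continuous_const) fun v => ?_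
    have h1 := hℓ _ (LinearMap.mem_range_self (dataMap j a hT) (0, v))
    rwa [hsplit, hℓ₁0, zero_apply, zero_add] at h1
  ext y
  · simpa [hsplit] using congrArg (fun f => f y) hℓ₁0
  · simpa [hsplit] using hℓ₂0 y

/-- `F - a (u, ·)` as an element of `L²(0,T;V')`. -/
noncomputable def residual (a : V →L[ℝ] V →L[ℝ] ℝ) {T : ℝ} (F : L2Time T (StrongDual ℝ V))
    (u : L2Time T V) : L2Time T (StrongDual ℝ V) :=
  F - a.compLpL 2 (volume.restrict (Ioo 0 T)) u

omit [CompleteSpace V] in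
theorem coeFn_residual (a : V →L[ℝ] V →L[ℝ] ℝ) {T : ℝ} (F : L2Time T (StrongDual ℝ V))
    (u : L2Time T V) :
    ∀ᵐ t ∂(volume.restrict (Ioo 0 T)), residual a F u t = F t - a (u t) := by
  filter_upwards [Lp.coeFn_sub F (a.compLpL 2 (volume.restrict (Ioo 0 T)) u),
    a.coeFn_compLpL (p := 2) u] with t h1 h2
  rw [← h2]
  exact h1

/-- The weak formulation, in distributional form, of the abstract parabolic problem. -/
def IsDistribSolution (j : V →L[ℝ] H) (a : V →L[ℝ] V →L[ℝ] ℝ) {T : ℝ}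
    (F : L2Time T (StrongDual ℝ V)) (u : L2Time T V) : Prop :=
  ∀ η : ℝ → ℝ, ContDiff ℝ ∞ η → HasCompactSupport η → tsupport η ⊆ Ioo 0 T → ∀ φ : V,
    ∫ t in Ioo 0 T, deriv η t * inner ℝ (j (u t)) (j φ) =
      - ∫ t in Ioo 0 T, η t * residual a F u t φ

/-- The energy estimate makes the solution map well defined and bounded on the dense range of
`dataMap`, so it extends continuously. Each claim is a closed condition on the data and is checked
on that range only. Values in the bounded continuous functions provide the representative with its
initial value. -/
theorem exists_distribSolution [CompleteSpace H] (j : V →L[ℝ] H) (hj : Function.Injective j)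
    (hjd : DenseRange j) (a : V →L[ℝ] V →L[ℝ] ℝ) (hsymm : ∀ v w, a v w = a w v) {α : ℝ}
    (hα : 0 < α) (hco : ∀ v, α * ‖v‖ ^ 2 ≤ a v v) {T : ℝ} (hT : 0 < T)
    (F : L2Time T (StrongDual ℝ V)) (h : H) :
    ∃ (u : L2Time T V) (U : BoundedContinuousFunction ℝ H), IsDistribSolution j a F u ∧
      (∀ᵐ t ∂(volume.restrict (Ioo 0 T)), U t = j (u t)) ∧ U 0 = h ∧
      (∀ t, ‖U t‖ ^ 2 ≤ ‖h‖ ^ 2 + α⁻¹ * ‖F‖ ^ 2) ∧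
      α * ‖u‖ ^ 2 ≤ ‖h‖ ^ 2 + α⁻¹ * ‖F‖ ^ 2 := by
  have hd := denseRange_dataMap j hj hjd a hsymm
    (fun v => (by positivity : 0 ≤ α * ‖v‖ ^ 2).trans (hco v)) hT.le
  have hb : ∃ C, ∀ x, ‖pathPair j hT.le x‖ ≤ C * ‖dataMap j a hT.le x‖ := by
    -- The factor `1 + α⁻¹` bounds the energy by the squared sup norm of the data pair; `max 1 α⁻¹`
    -- serves the sup bound (factor `1`) and the `L²` bound (factor `α⁻¹`) at once. Only boundedness
    -- matters here: the sharper estimates are carried over to the limit separately.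
    set K := max 1 α⁻¹ * (1 + α⁻¹)
    have hK : 0 ≤ 1 + α⁻¹ := by positivity
    refine ⟨√K, fun x => ?_⟩
    set d := ‖dataMap j a hT.le x‖
    have h1 : ‖(dataMap j a hT.le x).1‖ ^ 2 ≤ d ^ 2 := by gcongr; exact norm_fst_le _
    have h2 : ‖(dataMap j a hT.le x).2‖ ^ 2 ≤ d ^ 2 := by gcongr; exact norm_snd_le _
    have h3 : ‖(dataMap j a hT.le x).2‖ ^ 2 + α⁻¹ * ‖(dataMap j a hT.le x).1‖ ^ 2 ≤
        (1 + α⁻¹) * d ^ 2 := by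
      have : α⁻¹ * ‖(dataMap j a hT.le x).1‖ ^ 2 ≤ α⁻¹ * d ^ 2 := by gcongr
      linarith
    have h4 : ∀ r : ℝ, 0 ≤ r → r ^ 2 ≤ K * d ^ 2 → r ≤ √K * d := fun r hr h => by
      refine abs_le_of_sq_le_sq' ?_ (by positivity) |>.2
      rwa [mul_pow, Real.sq_sqrt (by positivity)]
    refine norm_prod_le_iff.2 ⟨h4 _ (norm_nonneg _) ?_, ?_⟩
    · have h5 := (norm_pathLp_sq_le j a hα hco hT.le x).trans h3
      calc ‖pathLp hT.le x‖ ^ 2 = α⁻¹ * (α * ‖pathLp hT.le x‖ ^ 2) := by field_simp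
        _ ≤ α⁻¹ * ((1 + α⁻¹) * d ^ 2) := by gcongr
        _ ≤ max 1 α⁻¹ * ((1 + α⁻¹) * d ^ 2) := by gcongr; exact le_max_right _ _
        _ = K * d ^ 2 := by ring
    · refine (BoundedContinuousFunction.norm_le (by positivity)).2 fun t =>
        h4 _ (norm_nonneg _) ?_
      calc ‖j (path hT.le x t)‖ ^ 2 ≤ 1 * ((1 + α⁻¹) * d ^ 2) := by
            rw [one_mul]; exact (norm_path_sq_le j a hα hco hT.le x t).trans h3
        _ ≤ max 1 α⁻¹ * ((1 + α⁻¹) * d ^ 2) := by gcongr; exact le_max_left _ _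
        _ = K * d ^ 2 := by ring
  set S := (pathPair j hT.le).extendOfNorm (dataMap j a hT.le)
  have hS : ∀ x, S (dataMap j a hT.le x) = pathPair j hT.le x :=
    LinearMap.extendOfNorm_eq hd hb
  have hc1 : Continuous fun y => (S y).1 := S.continuous.fst
  have hc2 : Continuous fun y => (S y).2 := S.continuous.snd
  have hev : ∀ t, Continuous fun y => (S y).2 t := fun t =>
    (BoundedContinuousFunction.evalCLM ℝ t).continuous.comp hc2
  refine ⟨(S (F, h)).1, (S (F, h)).2, ?_, ?_, ?_, ?_, ?_⟩
  · intro η h1 h2 h3 φ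
    have hmem : ∀ k : ℝ → ℝ, Continuous k → HasCompactSupport k →
        MemLp k 2 (volume.restrict (Ioo 0 T)) := fun k hk hkc =>
      (hk.memLp_of_hasCompactSupport hkc).restrict _
    have hη' := hmem _ (contDiff_infty_iff_deriv.1 h1).2.continuous h2.deriv
    refine hd.induction_on (p := fun y => ∫ t in Ioo 0 T,
      deriv η t * inner ℝ (j ((S y).1 t)) (j φ) = - ∫ t in Ioo 0 T, η t *
        (y.1 - a.compLpL 2 (volume.restrict (Ioo 0 T)) (S y).1 : L2Time T _) t φ) (F, h)
      (isClosed_eq ?_ (Continuous.neg ?_)) fun x => ?_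
    · have := (continuous_integral_mul hη' ((pullInner j).flip φ)).comp hc1
      exact this
    · exact (continuous_integral_mul (hmem η h1.continuous h2)
        (ContinuousLinearMap.apply ℝ ℝ φ)).comp (continuous_fst.sub
          ((ContinuousLinearMap.continuous _).comp hc1))
    · rw [hS]
      have hi := x.1.intervalIntegrable hT.le
      have hq : IntervalIntegrable (fun t => (pullInner j).flip φ (x.1 t)) volume 0 T := by
        rw [intervalIntegrable_iff] at hi ⊢
        exact ((pullInner j).flip φ).integrable_comp hi
      have h4 := integral_deriv_mul_primitive hq h1 h3 (inner ℝ (j x.2) (j φ))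
      rw [intervalIntegral_eq_Ioo _ hT.le, intervalIntegral_eq_Ioo _ hT.le] at h4
      refine Eq.trans (integral_congr_ae ?_) (h4.trans (congrArg Neg.neg (integral_congr_ae ?_)))
      · filter_upwards [coeFn_pathLp hT.le x, ae_restrict_mem measurableSet_Ioo] with t h5 ht
        change deriv η t * inner ℝ (j (pathLp hT.le x t)) (j φ) = _
        rw [h5, ContinuousLinearMap.intervalIntegral_comp_comm _ (hi.mono_set
          (uIcc_subset_uIcc_left (Icc_subset_uIcc (Ioo_subset_Icc_self ht)))), map_add,
          inner_add_left]
        rfl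
      · have h6 : (dataMap j a hT.le x).1 - a.compLpL 2 (volume.restrict (Ioo 0 T))
            (pathPair j hT.le x).1 = (pullInner j).compLpL 2 (volume.restrict (Ioo 0 T)) x.1 :=
          add_sub_cancel_right _ _
        rw [h6]
        filter_upwards [(pullInner j).coeFn_compLpL (p := 2) x.1] with t h7
        rw [h7]
        rfl
  · have h1 : BoundedContinuousFunction.toLp 2 (volume.restrict (Ioo 0 T)) ℝ (S (F, h)).2 =
        j.compLpL 2 (volume.restrict (Ioo 0 T)) (S (F, h)).1 := by
      refine hd.induction_on (p := fun y =>
        BoundedContinuousFunction.toLp 2 (volume.restrict (Ioo 0 T)) ℝ (S y).2 =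
          j.compLpL 2 (volume.restrict (Ioo 0 T)) (S y).1) (F, h)
        (isClosed_eq ((ContinuousLinearMap.continuous _).comp hc2)
          ((ContinuousLinearMap.continuous _).comp hc1)) fun x => ?_
      rw [hS]
      refine Lp.ext ?_
      filter_upwards [BoundedContinuousFunction.coeFn_toLp 2 (volume.restrict (Ioo 0 T)) ℝ
          (pathPair j hT.le x).2, j.coeFn_compLpL (p := 2) (pathPair j hT.le x).1,
        BoundedContinuousFunction.coeFn_toLp 2 (volume.restrict (Ioo 0 T)) ℝ (path hT.le x)]
        with t h1 h2 h3
      rw [h1, h2]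
      change j (path hT.le x t) = j (BoundedContinuousFunction.toLp 2 _ ℝ (path hT.le x) t)
      rw [h3]
    filter_upwards [BoundedContinuousFunction.coeFn_toLp 2 (volume.restrict (Ioo 0 T)) ℝ
      (S (F, h)).2, j.coeFn_compLpL (p := 2) (S (F, h)).1] with t h2 h3
    rw [← h2, h1, h3]
  · refine hd.induction_on (p := fun y => (S y).2 0 = y.2) (F, h)
      (isClosed_eq (hev 0) continuous_snd) fun x => ?_
    rw [hS]
    change j (path hT.le x 0) = j x.2
    rw [path_apply hT.le x (left_mem_Icc.2 hT.le), intervalIntegral.integral_same, add_zero]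
  · intro t
    refine hd.induction_on (p := fun y => ‖(S y).2 t‖ ^ 2 ≤ ‖y.2‖ ^ 2 + α⁻¹ * ‖y.1‖ ^ 2) (F, h)
      (isClosed_le ((hev t).norm.pow 2) (by fun_prop)) fun x => ?_
    rw [hS]
    exact norm_path_sq_le j a hα hco hT.le x t
  · refine hd.induction_on (p := fun y => α * ‖(S y).1‖ ^ 2 ≤ ‖y.2‖ ^ 2 + α⁻¹ * ‖y.1‖ ^ 2) (F, h)
      (isClosed_le (continuous_const.mul (hc1.norm.pow 2)) (by fun_prop)) fun x => ?_
    rw [hS]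
    exact norm_pathLp_sq_le j a hα hco hT.le x

/-- The equation is integrated in time before it is tested, so that only `u` and its primitive
occur, and no time derivative of `u` is paired with `u`. -/
theorem distribSolution_unique (j : V →L[ℝ] H) (hj : Function.Injective j)
    (a : V →L[ℝ] V →L[ℝ] ℝ) (hsymm : ∀ v w, a v w = a w v) (hnn : ∀ v, 0 ≤ a v v)
    {T : ℝ} (hT : 0 < T) (u : L2Time T V) (hu : IsDistribSolution j a 0 u)
    (U : ℝ → H) (hU : ContinuousOn U (Icc 0 T))
    (hUu : ∀ᵐ t ∂(volume.restrict (Ioo 0 T)), U t = j (u t)) (hU0 : U 0 = 0) : u = 0 := by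
  have hi := u.intervalIntegrable hT.le
  have key : ∀ φ : V, ∀ t ∈ Icc 0 T, inner ℝ (U t) (j φ) = - a (∫ τ in 0..t, u τ) φ := by
    intro φ t ht
    have hq : IntervalIntegrable (fun t => - a.flip φ (u t)) volume 0 T := by
      refine IntervalIntegrable.neg ?_
      rw [intervalIntegrable_iff] at hi ⊢
      exact (a.flip φ).integrable_comp hi
    have h1 := eq_add_integral_of_integral_deriv_mul hT
      (hU.inner (𝕜 := ℝ) (continuousOn_const (c := j φ))) hq (fun η h1 h2 h3 => by
        rw [intervalIntegral_eq_Ioo _ hT.le, intervalIntegral_eq_Ioo _ hT.le]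
        refine Eq.trans (integral_congr_ae ?_)
          ((hu η h1 h2 h3 φ).trans (congrArg Neg.neg (integral_congr_ae ?_)))
        · filter_upwards [hUu] with t ht
          rw [ht]
        · filter_upwards [coeFn_residual a 0 u,
            Lp.coeFn_zero (StrongDual ℝ V) 2 (volume.restrict (Ioo 0 T))] with t h4 h5
          rw [h4, h5, Pi.zero_apply, zero_sub]
          rfl) t ht
    rw [h1, hU0, inner_zero_left, zero_add, intervalIntegral.integral_neg,
      ContinuousLinearMap.intervalIntegral_comp_comm _ (hi.mono_set
          (uIcc_subset_uIcc_left (Icc_subset_uIcc ht)))]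
    rfl
  refine ae_eq_zero_of_integral_primitive_nonpos j hj a hsymm hnn hT.le u (le_of_eq ?_)
  refine (integral_congr_ae ?_).trans (integral_zero _ _)
  filter_upwards [hUu, ae_restrict_mem measurableSet_Ioo] with t h1 ht
  -- The test vector may depend on `t` because `key` holds for every `φ` and every `t`, with no
  -- exceptional set depending on `φ`.
  have h2 := key (u t) t (Ioo_subset_Icc_self ht)
  rw [h1, real_inner_self_eq_norm_sq] at h2
  rw [h2, neg_add_cancel]

end Parabolic

/-! ### Hilbert structure and completeness of `H^s(ℝⁿ)`. -/

section SobolevSpace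

theorem memLp_mul_of_norm_le_one {n : ℕ} {m : Rn n → ℂ} (hm : Measurable m)
    (h1 : ∀ ξ, ‖m ξ‖ ≤ 1) (g : Lp ℂ 2 (volume : Measure (Rn n))) :
    MemLp (fun ξ => m ξ * g ξ) 2 volume :=
  (Lp.memLp g).of_le (hm.aestronglyMeasurable.mul (Lp.aestronglyMeasurable g))
    (Filter.Eventually.of_forall fun ξ => by
      rw [norm_mul]; exact mul_le_of_le_one_left (norm_nonneg _) (h1 ξ))

/-- Multiplication by a measurable function that is bounded by `1`, on `L²`. -/
noncomputable def mulLp {n : ℕ} (m : Rn n → ℂ) (hm : Measurable m) (h1 : ∀ ξ, ‖m ξ‖ ≤ 1) :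
    Lp ℂ 2 (volume : Measure (Rn n)) →L[ℂ] Lp ℂ 2 (volume : Measure (Rn n)) :=
  LinearMap.mkContinuous
    { toFun := fun g => (memLp_mul_of_norm_le_one hm h1 g).toLp _
      map_add' := fun f g => by
        refine Lp.ext ?_
        filter_upwards [(memLp_mul_of_norm_le_one hm h1 (f + g)).coeFn_toLp, (memLp_mul_of_norm_le_one hm h1 f).coeFn_toLp, (memLp_mul_of_norm_le_one hm h1 g).coeFn_toLp,
          Lp.coeFn_add f g, Lp.coeFn_add ((memLp_mul_of_norm_le_one hm h1 f).toLp _) ((memLp_mul_of_norm_le_one hm h1 g).toLp _)] with ξ a b c d e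
        rw [a, e, Pi.add_apply, b, c, d, Pi.add_apply, mul_add]
      map_smul' := fun c g => by
        refine Lp.ext ?_
        filter_upwards [(memLp_mul_of_norm_le_one hm h1 (c • g)).coeFn_toLp, (memLp_mul_of_norm_le_one hm h1 g).coeFn_toLp,
          Lp.coeFn_smul c g, Lp.coeFn_smul c ((memLp_mul_of_norm_le_one hm h1 g).toLp _)] with ξ a b d e
        rw [a, RingHom.id_apply, e, Pi.smul_apply, b, d, Pi.smul_apply, smul_eq_mul, smul_eq_mul]
        ring } 1 (fun g => by
    rw [one_mul]
    refine Lp.norm_le_norm_of_ae_le ?_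
    filter_upwards [(memLp_mul_of_norm_le_one hm h1 g).coeFn_toLp] with ξ a
    simp only [LinearMap.coe_mk, AddHom.coe_mk]
    rw [a, norm_mul]
    exact mul_le_of_le_one_left (norm_nonneg _) (h1 ξ))

theorem coeFn_mulLp {n : ℕ} (m : Rn n → ℂ) (hm : Measurable m) (h1 : ∀ ξ, ‖m ξ‖ ≤ 1)
    (g : Lp ℂ 2 (volume : Measure (Rn n))) : mulLp m hm h1 g =ᵐ[volume] fun ξ => m ξ * g ξ := by
  exact (memLp_mul_of_norm_le_one hm h1 g).coeFn_toLp

theorem norm_mulLp_le {n : ℕ} (m : Rn n → ℂ) (hm : Measurable m) (h1 : ∀ ξ, ‖m ξ‖ ≤ 1)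
    (g : Lp ℂ 2 (volume : Measure (Rn n))) : ‖mulLp m hm h1 g‖ ≤ ‖g‖ := by
  refine Lp.norm_le_norm_of_ae_le ?_
  filter_upwards [coeFn_mulLp m hm h1 g] with ξ a
  rw [a, norm_mul]
  exact mul_le_of_le_one_left (norm_nonneg _) (h1 ξ)

theorem norm_fourierL2 (n : ℕ) (v : Lp ℝ 2 (volume : Measure (Rn n))) :
    ‖fourierL2 n v‖ = ‖v‖ := by
  have h : ‖Complex.ofRealCLM.compLp v‖ = ‖v‖ := by
    rw [Lp.norm_def, Lp.norm_def]
    congr 1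
    refine eLpNorm_congr_norm_ae ?_
    filter_upwards [Complex.ofRealCLM.coeFn_compLp v] with x hx
    rw [hx]
    simp
  rw [← h]
  exact (Lp.fourierTransformₗᵢ (Rn n) ℂ).norm_map _

theorem Sobolev.norm_eq {n : ℕ} {s : ℝ} (v : Sobolev n s) : ‖v‖ = ‖Sobolev.weighted n s v‖ := rfl

noncomputable instance (n : ℕ) (s : ℝ) : InnerProductSpace ℝ (Sobolev n s) where
  inner v w := inner ℝ (Sobolev.weighted n s v) (Sobolev.weighted n s w)
  norm_sq_eq_re_inner v := norm_sq_eq_re_inner (𝕜 := ℝ) (Sobolev.weighted n s v)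
  conj_inner_symm v w := inner_conj_symm _ _
  add_left u v w := by rw [map_add, inner_add_left]
  smul_left v w r := by rw [map_smul, inner_smul_left]

theorem Sobolev.coeFn_weighted {n : ℕ} {s : ℝ} (v : Sobolev n s) :
    Sobolev.weighted n s v =ᵐ[volume] weightedFourier n s (Sobolev.toL2 n s v) :=
  (Sobolev.memLp n s v).coeFn_toLp

/-- Multiplication by `(1 + |ξ|²)^(-s/2)`. -/
noncomputable def besselMul (n : ℕ) {s : ℝ} (hs : 0 ≤ s) :
    Lp ℂ 2 (volume : Measure (Rn n)) →L[ℂ] Lp ℂ 2 (volume : Measure (Rn n)) :=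
  mulLp (fun ξ => (((1 + ‖ξ‖ ^ 2) ^ (-(s / 2)) : ℝ) : ℂ)) (by fun_prop) (fun ξ => by
    rw [Complex.norm_real, Real.norm_of_nonneg (by positivity)]
    exact Real.rpow_le_one_of_one_le_of_nonpos (by nlinarith [sq_nonneg ‖ξ‖]) (by linarith))

theorem coeFn_besselMul (n : ℕ) {s : ℝ} (hs : 0 ≤ s) (g : Lp ℂ 2 (volume : Measure (Rn n))) :
    besselMul n hs g =ᵐ[volume] fun ξ => (((1 + ‖ξ‖ ^ 2) ^ (-(s / 2)) : ℝ) : ℂ) * g ξ :=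
  coeFn_mulLp _ _ _ _

theorem weight_mul_inv {n : ℕ} (s : ℝ) (ξ : Rn n) :
    (((1 + ‖ξ‖ ^ 2) ^ (-(s / 2)) : ℝ) : ℂ) * (((1 + ‖ξ‖ ^ 2) ^ (s / 2) : ℝ) : ℂ) = 1 := by
  rw [← Complex.ofReal_mul, ← Real.rpow_add (by positivity)]
  simp

theorem besselMul_weighted {n : ℕ} {s : ℝ} (hs : 0 ≤ s) (v : Sobolev n s) :
    besselMul n hs (Sobolev.weighted n s v) = fourierL2 n (Sobolev.toL2 n s v) := by
  refine Lp.ext ?_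
  filter_upwards [coeFn_besselMul n hs (Sobolev.weighted n s v), Sobolev.coeFn_weighted v]
    with ξ h1 h2
  rw [h1, h2, weightedFourier, Complex.real_smul, ← mul_assoc, weight_mul_inv, one_mul]

theorem Sobolev.norm_toL2_le {n : ℕ} {s : ℝ} (hs : 0 ≤ s) (v : Sobolev n s) :
    ‖Sobolev.toL2 n s v‖ ≤ ‖v‖ := by
  rw [← norm_fourierL2, ← besselMul_weighted hs, Sobolev.norm_eq]
  exact norm_mulLp_le _ _ _ _

/-- A Cauchy sequence converges in `L²` and so do its weighted transforms. Multiplication by the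
inverse weight is bounded, which links the two limits. Taking the limit from real `L²` keeps it
real-valued. -/
theorem Sobolev.completeSpace (n : ℕ) {s : ℝ} (hs : 0 ≤ s) : CompleteSpace (Sobolev n s) := by
  refine Metric.complete_of_cauchySeq_tendsto fun u hu => ?_
  set toL2 : Sobolev n s →L[ℝ] Lp ℝ 2 (volume : Measure (Rn n)) :=
    (Sobolev.toL2 n s).mkContinuous 1 (fun v => by
      rw [one_mul]; exact Sobolev.norm_toL2_le hs v)
  set W : Sobolev n s →L[ℝ] Lp ℂ 2 (volume : Measure (Rn n)) :=
    (Sobolev.weighted n s).mkContinuous 1 (fun v => by rw [one_mul]; exact le_rfl)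
  set Φ : Lp ℝ 2 (volume : Measure (Rn n)) →L[ℝ] Lp ℂ 2 (volume : Measure (Rn n)) :=
    (fourierL2 n).mkContinuous 1 (fun v => by rw [one_mul, norm_fourierL2])
  obtain ⟨g, hg⟩ := cauchySeq_tendsto_of_complete (W.uniformContinuous.comp_cauchySeq hu)
  obtain ⟨v, hv⟩ := cauchySeq_tendsto_of_complete (toL2.uniformContinuous.comp_cauchySeq hu)
  have h1 : Φ v = besselMul n hs g := by
    refine tendsto_nhds_unique ((Φ.continuous.tendsto _).comp hv) ?_
    refine (((besselMul n hs).continuous.tendsto _).comp hg).congr fun k => ?_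
    exact besselMul_weighted hs (u k)
  have h2 : weightedFourier n s v =ᵐ[volume] g := by
    have h3 := coeFn_besselMul n hs g
    rw [← h1] at h3
    filter_upwards [h3] with ξ hξ
    change _ • Φ v ξ = _
    rw [hξ, Complex.real_smul, ← mul_assoc, mul_comm (Complex.ofReal _), weight_mul_inv, one_mul]
  have hmem : MemLp (weightedFourier n s v) 2 volume := (memLp_congr_ae h2).2 (Lp.memLp g)
  obtain ⟨w, hw⟩ : ∃ w : Sobolev n s, Sobolev.toL2 n s w = v := ⟨⟨v, hmem⟩, rfl⟩
  refine ⟨w, ?_⟩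
  have h3 : Sobolev.weighted n s w = g := by
    refine Lp.ext ((Sobolev.coeFn_weighted w).trans ?_)
    rwa [hw]
  rw [tendsto_iff_norm_sub_tendsto_zero] at hg ⊢
  refine hg.congr fun k => ?_
  rw [Sobolev.norm_eq, map_sub, h3]
  rfl

end SobolevSpace

/-! ### The embedding of `H̃^s(Ω)` into `L²(Ω)`: injectivity and dense range. -/

section Htilde

variable {n : ℕ} {s : ℝ} {Ω : Set (Rn n)}

theorem norm_restr_le (hs : 0 ≤ s) (v : Htilde n s Ω) : ‖restr n s Ω v‖ ≤ ‖v‖ := by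
  refine le_trans ?_ (Sobolev.norm_toL2_le hs (v : Sobolev n s))
  rw [Lp.norm_def, Lp.norm_def]
  refine ENNReal.toReal_mono (Lp.eLpNorm_ne_top _) ?_
  exact (eLpNorm_congr_ae (LpToLpRestrictCLM_coeFn ℝ Ω _)).trans_le
    (eLpNorm_mono_measure _ Measure.restrict_le_self)

/-- The restriction `H̃^s(Ω) → L²(Ω)` as a continuous linear map. -/
noncomputable def restrL (n : ℕ) {s : ℝ} (hs : 0 ≤ s) (Ω : Set (Rn n)) :
    Htilde n s Ω →L[ℝ] L2 n Ω :=
  (restr n s Ω).mkContinuous 1 (fun v => by rw [one_mul]; exact norm_restr_le hs v)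

/-- Test functions vanish outside Ω, and this condition is closed under `L²` convergence. It is what
makes the restriction to Ω injective. -/
theorem ae_rep_eq_zero (hs : 0 ≤ s) (hΩ : MeasurableSet Ω) (v : Htilde n s Ω) :
    ∀ᵐ x, x ∉ Ω → rep v x = 0 := by
  set toL2 : Sobolev n s →L[ℝ] Lp ℝ 2 (volume : Measure (Rn n)) :=
    (Sobolev.toL2 n s).mkContinuous 1 (fun v => by
      rw [one_mul]; exact Sobolev.norm_toL2_le hs v)
  set R := LpToLpRestrictCLM (Rn n) ℝ ℝ volume 2 Ωᶜ ∘L toL2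
  have h1 : (v : Sobolev n s) ∈ {w | R w = 0} := by
    refine closure_minimal ?_ (isClosed_eq R.continuous continuous_const) v.2
    rintro w ⟨φ, -, -, hφ, hw⟩
    refine (Lp.eq_zero_iff_ae_eq_zero).2 ?_
    filter_upwards [LpToLpRestrictCLM_coeFn ℝ Ωᶜ (toL2 w), ae_restrict_of_ae hw,
      ae_restrict_mem hΩ.compl] with x h1 h2 h3
    refine (h1.trans h2).trans (image_eq_zero_of_notMem_tsupport fun h => h3 (hφ h))
  have h2 := (Lp.eq_zero_iff_ae_eq_zero).1 h1
  have h3 := LpToLpRestrictCLM_coeFn ℝ Ωᶜ (toL2 (v : Sobolev n s))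
  rw [Filter.EventuallyEq, ae_restrict_iff' hΩ.compl] at h2 h3
  filter_upwards [h2, h3] with x h4 h5 hx
  exact (h5 hx).symm.trans (h4 hx)

theorem restrL_injective (hs : 0 ≤ s) (hΩ : MeasurableSet Ω) :
    Function.Injective (restrL n hs Ω) := by
  rw [injective_iff_map_eq_zero]
  intro v hv
  have h1 := (Lp.eq_zero_iff_ae_eq_zero).1 hv
  have h2 := LpToLpRestrictCLM_coeFn ℝ Ω (Sobolev.toL2 n s (v : Sobolev n s))
  rw [Filter.EventuallyEq, ae_restrict_iff' hΩ] at h1 h2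
  have h3 : Sobolev.toL2 n s (v : Sobolev n s) = 0 := by
    rw [Lp.eq_zero_iff_ae_eq_zero]
    filter_upwards [h1, h2, ae_rep_eq_zero hs hΩ v] with x h4 h5 h6
    by_cases hx : x ∈ Ω
    · exact (h5 hx).symm.trans (h4 hx)
    · exact h6 hx
  exact Subtype.ext (Subtype.ext h3)

/-- The complexified function is Schwartz, hence so is its transform, and the weight has temperate
growth. -/
theorem exists_sobolev_of_contDiff {φ : Rn n → ℝ} (s : ℝ) (hφ : ContDiff ℝ ∞ φ)
    (hc : HasCompactSupport φ) : ∃ v : Sobolev n s, Sobolev.toL2 n s v =ᵐ[volume] φ := by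
  have hcC : HasCompactSupport fun x => (φ x : ℂ) := hc.comp_left (g := Complex.ofReal) rfl
  have hφC : ContDiff ℝ ∞ fun x => (φ x : ℂ) := Complex.ofRealCLM.contDiff.comp hφ
  set g : SchwartzMap (Rn n) ℂ := hcC.toSchwartzMap hφC with hg
  have hφL : MemLp φ 2 volume := hφ.continuous.memLp_of_hasCompactSupport hc
  have h1 : Complex.ofRealCLM.compLp (hφL.toLp φ) = g.toLp 2 := by
    refine Lp.ext ?_
    filter_upwards [Complex.ofRealCLM.coeFn_compLp (hφL.toLp φ), hφL.coeFn_toLp,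
      g.coeFn_toLp 2 volume] with x h2 h3 h4
    rw [h2, h3, h4]
    rfl
  have h2 : fourierL2 n (hφL.toLp φ) = (FourierTransform.fourier g).toLp 2 := by
    rw [← SchwartzMap.toLp_fourier_eq, ← h1]
    rfl
  have hw : (fun ξ : Rn n => (1 + ‖ξ‖ ^ 2) ^ (s / 2)).HasTemperateGrowth :=
    Function.hasTemperateGrowth_one_add_norm_sq_rpow (Rn n) (s / 2)
  have h3 : MemLp (weightedFourier n s (hφL.toLp φ)) 2 volume := by
    refine (memLp_congr_ae ?_).2
      ((SchwartzMap.smulLeftCLM ℂ (fun ξ : Rn n => (1 + ‖ξ‖ ^ 2) ^ (s / 2))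
        (FourierTransform.fourier g)).memLp 2 volume)
    filter_upwards [(FourierTransform.fourier g).coeFn_toLp 2 volume] with ξ h4
    rw [SchwartzMap.smulLeftCLM_apply_apply hw, weightedFourier, h2, h4]
  exact ⟨(⟨hφL.toLp φ, h3⟩ : sobolevSubmodule n s), hφL.coeFn_toLp⟩

/-- The range contains all test functions, so anything orthogonal to it vanishes by the fundamental
lemma of the calculus of variations. -/
theorem denseRange_restrL (hs : 0 ≤ s) (hΩ : IsOpen Ω) : DenseRange (restrL n hs Ω) := by
  have h : (LinearMap.range (restrL n hs Ω).toLinearMap).topologicalClosure = ⊤ := by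
    rw [Submodule.topologicalClosure_eq_top_iff, Submodule.eq_bot_iff]
    intro w hw
    have h1 : ∀ᵐ x, x ∈ Ω → w x = 0 := by
      refine hΩ.ae_eq_zero_of_integral_contDiff_smul_eq_zero ?_ fun φ h1 h2 h3 => ?_
      · refine (locallyIntegrableOn_of_locallyIntegrable_restrict ?_)
        exact (Lp.memLp w).locallyIntegrable one_le_two
      · obtain ⟨v, hv⟩ := exists_sobolev_of_contDiff s h1 h2
        have hvH : v ∈ Htilde n s Ω := subset_closure ⟨φ, h1, h2, h3, hv⟩
        have h4 := (Submodule.mem_orthogonal _ _).1 hw _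
          (LinearMap.mem_range_self (restrL n hs Ω).toLinearMap ⟨v, hvH⟩)
        rw [L2.inner_def] at h4
        rw [← setIntegral_eq_integral_of_forall_compl_eq_zero (s := Ω) fun x hx => by
          rw [image_eq_zero_of_notMem_tsupport fun h => hx (h3 h), zero_smul]]
        rw [← h4]
        refine integral_congr_ae ?_
        filter_upwards [LpToLpRestrictCLM_coeFn ℝ Ω (Sobolev.toL2 n s v), ae_restrict_of_ae hv]
          with x h5 h6
        have h7 : restr n s Ω ⟨v, hvH⟩ x = φ x := h5.trans h6
        change _ = inner ℝ (restr n s Ω ⟨v, hvH⟩ x) (w x)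
        rw [h7]
        simp [mul_comm]
    rw [Lp.eq_zero_iff_ae_eq_zero, Filter.EventuallyEq, ae_restrict_iff' hΩ.measurableSet]
    exact h1
  exact (Submodule.dense_iff_topologicalClosure_eq_top).2 h

end Htilde

/-! ### Translations and the Fourier transform on `L²`. -/

section Translation

theorem Lp_enorm_sq {α E : Type*} [MeasurableSpace α] {μ : Measure α} [NormedAddCommGroup E]
    (f : Lp E 2 μ) : ‖f‖ₑ ^ 2 = ∫⁻ x, ‖f x‖ₑ ^ 2 ∂μ := by
  rw [Lp.enorm_def, eLpNorm_eq_lintegral_rpow_enorm_toReal (by norm_num) (by norm_num),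
    ← ENNReal.rpow_natCast, ← ENNReal.rpow_mul]
  simp

/-- The phase `exp (2πi ⟪h, ξ⟫)`. -/
noncomputable def phase {n : ℕ} (h ξ : Rn n) : ℂ :=
  Complex.exp (Complex.I * (2 * Real.pi * inner ℝ h ξ : ℝ))

theorem measurable_phase {n : ℕ} : Measurable fun p : Rn n × Rn n => phase p.1 p.2 := by
  unfold phase; fun_prop

theorem measurable_phase_right {n : ℕ} (h : Rn n) : Measurable (phase h) := by
  unfold phase; fun_prop

theorem norm_phase {n : ℕ} (h ξ : Rn n) : ‖phase h ξ‖ = 1 := by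
  rw [phase, mul_comm, Complex.norm_exp_ofReal_mul_I]

theorem fourierChar_inner {n : ℕ} (h ξ : Rn n) :
    (Real.fourierChar (inner ℝ h ξ) : ℂ) = phase h ξ := by
  rw [Real.fourierChar_apply, phase, mul_comm]

/-- The translation `g ↦ g (· + h)` on `L²`. -/
noncomputable def translateLp {n : ℕ} (h : Rn n) :
    Lp ℂ 2 (volume : Measure (Rn n)) →ₗᵢ[ℂ] Lp ℂ 2 (volume : Measure (Rn n)) :=
  Lp.compMeasurePreservingₗᵢ ℂ (fun x => x + h) (measurePreserving_add_right volume h)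

theorem coeFn_translateLp {n : ℕ} (h : Rn n) (g : Lp ℂ 2 (volume : Measure (Rn n))) :
    translateLp h g =ᵐ[volume] fun x => g (x + h) :=
  Lp.coeFn_compMeasurePreserving g (measurePreserving_add_right volume h)

/-- The multiplication by `exp (2πi ⟪h, ξ⟫)` on `L²`. -/
noncomputable def modulateLp {n : ℕ} (h : Rn n) :
    Lp ℂ 2 (volume : Measure (Rn n)) →L[ℂ] Lp ℂ 2 (volume : Measure (Rn n)) :=
  mulLp (phase h) (measurable_phase_right h) (fun ξ => (norm_phase h ξ).le)

theorem coeFn_modulateLp {n : ℕ} (h : Rn n) (g : Lp ℂ 2 (volume : Measure (Rn n))) :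
    modulateLp h g =ᵐ[volume] fun ξ => phase h ξ * g ξ :=
  coeFn_mulLp _ _ _ _

/-- The Fourier transform turns the translation by `h` into the multiplication by
`exp (2πi ⟪h, ξ⟫)`. -/
theorem fourierTransform_translate {n : ℕ} (h : Rn n)
    (g : Lp ℂ 2 (volume : Measure (Rn n))) :
    Lp.fourierTransformₗᵢ (Rn n) ℂ (translateLp h g) =
      modulateLp h (Lp.fourierTransformₗᵢ (Rn n) ℂ g) := by
  have hd := SchwartzMap.denseRange_toLpCLM (F := ℂ) (p := 2) (μ := (volume : Measure (Rn n)))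
    ENNReal.ofNat_ne_top
  refine hd.induction_on (p := fun g => Lp.fourierTransformₗᵢ (Rn n) ℂ (translateLp h g) =
      modulateLp h (Lp.fourierTransformₗᵢ (Rn n) ℂ g)) g ?_ fun f => ?_
  · refine isClosed_eq ?_ ?_
    · exact (LinearIsometryEquiv.continuous _).comp (LinearIsometry.continuous _)
    · exact (ContinuousLinearMap.continuous _).comp (LinearIsometryEquiv.continuous _)
  · set f' : SchwartzMap (Rn n) ℂ := f.compSubConstCLM ℝ (-h) with hf'
    have h1 : translateLp h (SchwartzMap.toLpCLM ℝ ℂ 2 volume f) = f'.toLp 2 := by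
      refine Lp.ext ?_
      refine (coeFn_translateLp h _).trans ?_
      filter_upwards [(measurePreserving_add_right volume h).quasiMeasurePreserving.ae
        (f.coeFn_toLp 2 volume), f'.coeFn_toLp 2 volume] with x h2 h3
      rw [h3, hf', SchwartzMap.compSubConstCLM_apply, sub_neg_eq_add]
      exact h2
    rw [h1]
    change FourierTransform.fourier (f'.toLp 2) = modulateLp h (FourierTransform.fourier (f.toLp 2))
    rw [SchwartzMap.toLp_fourier_eq, SchwartzMap.toLp_fourier_eq]
    refine Lp.ext ?_
    filter_upwards [(FourierTransform.fourier f').coeFn_toLp 2 volume,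
      (FourierTransform.fourier f).coeFn_toLp 2 volume,
      coeFn_modulateLp h ((FourierTransform.fourier f).toLp 2)] with ξ h2 h3 h4
    rw [h2, h4, h3, SchwartzMap.fourier_coe, SchwartzMap.fourier_coe]
    have h5 := VectorFourier.fourierIntegral_comp_add_right Real.fourierChar
      (volume : Measure (Rn n)) (innerₗ (Rn n)) f h
    have h6 : (f' : Rn n → ℂ) = (f : Rn n → ℂ) ∘ fun v => v + h := by
      ext x
      rw [hf', SchwartzMap.compSubConstCLM_apply, sub_neg_eq_add]
      rfl
    rw [h6]
    rw [← fourierChar_inner]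
    exact congrFun h5 ξ

theorem lintegral_translate_sub {n : ℕ} (v : Lp ℝ 2 (volume : Measure (Rn n))) (h : Rn n) :
    ∫⁻ x, ‖v (x + h) - v x‖ₑ ^ 2 =
      ∫⁻ ξ, ‖phase h ξ - 1‖ₑ ^ 2 * ‖fourierL2 n v ξ‖ₑ ^ 2 := by
  set g : Lp ℂ 2 (volume : Measure (Rn n)) := Complex.ofRealCLM.compLp v with hg
  have h1 : ‖translateLp h g - g‖ₑ ^ 2 = ∫⁻ x, ‖v (x + h) - v x‖ₑ ^ 2 := by
    rw [Lp_enorm_sq]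
    refine lintegral_congr_ae ?_
    filter_upwards [Lp.coeFn_sub (translateLp h g) g, Complex.ofRealCLM.coeFn_compLp v,
      coeFn_translateLp h g,
      (measurePreserving_add_right volume h).quasiMeasurePreserving.ae
        (Complex.ofRealCLM.coeFn_compLp v)] with x h2 h3 h4 h5
    have h6 : translateLp h g x = v (x + h) := h4.trans h5
    rw [h2, Pi.sub_apply, h6, h3]
    simp only [Complex.ofRealCLM_apply, ← Complex.ofReal_sub]
    rw [← ofReal_norm, ← ofReal_norm, Complex.norm_real]
  rw [← h1, ← (Lp.fourierTransformₗᵢ (Rn n) ℂ).enorm_map, map_sub, fourierTransform_translate,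
    Lp_enorm_sq]
  refine lintegral_congr_ae ?_
  have h7 : Lp.fourierTransformₗᵢ (Rn n) ℂ g = fourierL2 n v := rfl
  rw [h7]
  filter_upwards [Lp.coeFn_sub (modulateLp h (fourierL2 n v)) (fourierL2 n v),
    coeFn_modulateLp h (fourierL2 n v)] with ξ h2 h3
  rw [h2, Pi.sub_apply, h3, ← mul_pow, ← enorm_mul, sub_mul, one_mul]

end Translation

/-! ### The Gagliardo seminorm as a Fourier multiplier. -/

section Gagliardo

/-- The kernel `|h|^{-(n+2s)}`. -/
noncomputable def fracKernel (n : ℕ) (s : ℝ) (h : Rn n) : ℝ := (‖h‖ ^ ((n : ℝ) + 2 * s))⁻¹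

/-- The difference quotient `(v(x) - v(y)) / |x-y|^{(n+2s)/2}`. -/
noncomputable def diffQuot (n : ℕ) (s : ℝ) (v : Rn n → ℝ) (p : Rn n × Rn n) : ℝ :=
  (v p.1 - v p.2) / ‖p.1 - p.2‖ ^ (((n : ℝ) + 2 * s) / 2)

/-- The symbol `∫ |exp (2πi ⟪h, ξ⟫) - 1|² |h|^{-(n+2s)} dh` of the fractional Laplacian, up to
a constant factor. -/
noncomputable def fracSymbol (n : ℕ) (s : ℝ) (ξ : Rn n) : ℝ≥0∞ :=
  ∫⁻ h, ENNReal.ofReal (fracKernel n s h) * ‖phase h ξ - 1‖ₑ ^ 2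

theorem fracKernel_nonneg (n : ℕ) (s : ℝ) (h : Rn n) : 0 ≤ fracKernel n s h := by
  unfold fracKernel; positivity

theorem measurable_fracKernel (n : ℕ) (s : ℝ) : Measurable (fracKernel n s) := by
  unfold fracKernel; fun_prop

theorem diffQuot_sq (n : ℕ) (s : ℝ) (v w : Rn n → ℝ) (p : Rn n × Rn n) :
    diffQuot n s v p * diffQuot n s w p =
      (v p.1 - v p.2) * (w p.1 - w p.2) / ‖p.1 - p.2‖ ^ ((n : ℝ) + 2 * s) := by
  rw [diffQuot, diffQuot, div_mul_div_comm, ← sq, ← Real.rpow_natCast, ← Real.rpow_mul (by positivity)]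
  norm_num

theorem enorm_diffQuot_sq (n : ℕ) (s : ℝ) (v : Rn n → ℝ) (p : Rn n × Rn n) :
    ‖diffQuot n s v p‖ₑ ^ 2 =
      ENNReal.ofReal (fracKernel n s (p.1 - p.2)) * ‖v p.1 - v p.2‖ₑ ^ 2 := by
  rw [← ofReal_norm, ← ofReal_norm, ← ENNReal.ofReal_pow (by positivity),
    ← ENNReal.ofReal_pow (by positivity), ← ENNReal.ofReal_mul (fracKernel_nonneg _ _ _),
    Real.norm_eq_abs, Real.norm_eq_abs, sq_abs, sq_abs, sq, diffQuot_sq, fracKernel]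
  congr 1
  ring

theorem measurable_diffQuot {n : ℕ} {s : ℝ} {v : Rn n → ℝ} (hv : Measurable v) :
    Measurable (diffQuot n s v) := by
  unfold diffQuot; fun_prop

/-- The Gagliardo seminorm in terms of the Fourier transform. -/
theorem lintegral_diffQuot_eq {n : ℕ} (s : ℝ) (v : Lp ℝ 2 (volume : Measure (Rn n))) :
    ∫⁻ p, ‖diffQuot n s v p‖ₑ ^ 2 = ∫⁻ ξ, fracSymbol n s ξ * ‖fourierL2 n v ξ‖ₑ ^ 2 := by
  have hv : Measurable v := (Lp.stronglyMeasurable v).measurable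
  have hF : Measurable (fourierL2 n v) := (Lp.stronglyMeasurable _).measurable
  have hk := measurable_fracKernel n s
  calc ∫⁻ p, ‖diffQuot n s v p‖ₑ ^ 2
      = ∫⁻ y, ∫⁻ x, ‖diffQuot n s v (x, y)‖ₑ ^ 2 :=
        lintegral_prod_symm _ ((measurable_diffQuot hv).enorm.pow_const 2).aemeasurable
    _ = ∫⁻ y, ∫⁻ h, ENNReal.ofReal (fracKernel n s h) * ‖v (y + h) - v y‖ₑ ^ 2 := by
        refine lintegral_congr fun y => ?_
        -- Substituting x = h + y makes the kernel depend on `h` alone, so that Plancherel applies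
        -- for each fixed `h`.
        rw [← lintegral_add_right_eq_self _ y]
        refine lintegral_congr fun h => ?_
        rw [enorm_diffQuot_sq, add_sub_cancel_right, add_comm h y]
    _ = ∫⁻ h, ∫⁻ y, ENNReal.ofReal (fracKernel n s h) * ‖v (y + h) - v y‖ₑ ^ 2 := by
        refine lintegral_lintegral_swap (Measurable.aemeasurable ?_)
        unfold Function.uncurry
        fun_prop
    _ = ∫⁻ h, ∫⁻ ξ, ENNReal.ofReal (fracKernel n s h) *
          (‖phase h ξ - 1‖ₑ ^ 2 * ‖fourierL2 n v ξ‖ₑ ^ 2) := by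
        refine lintegral_congr fun h => ?_
        rw [lintegral_const_mul' _ _ ENNReal.ofReal_ne_top, lintegral_translate_sub,
          lintegral_const_mul' _ _ ENNReal.ofReal_ne_top]
    _ = ∫⁻ ξ, ∫⁻ h, ENNReal.ofReal (fracKernel n s h) *
          (‖phase h ξ - 1‖ₑ ^ 2 * ‖fourierL2 n v ξ‖ₑ ^ 2) := by
        refine lintegral_lintegral_swap (Measurable.aemeasurable ?_)
        have := measurable_phase (n := n)
        unfold Function.uncurry
        fun_prop
    _ = ∫⁻ ξ, fracSymbol n s ξ * ‖fourierL2 n v ξ‖ₑ ^ 2 := by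
        refine lintegral_congr fun ξ => ?_
        rw [fracSymbol, ← lintegral_mul_const' _ _ (by finiteness)]
        simp only [mul_assoc]

end Gagliardo

/-! ### Two-sided bounds for the symbol. -/

section Symbol

variable {n : ℕ} {s : ℝ}

theorem norm_phase_sub_one_sq_le (h ξ : Rn n) {ρ : ℝ} (hρ : ‖ξ‖ ≤ ρ) :
    ‖phase h ξ - 1‖ ^ 2 ≤ 4 * Real.pi ^ 2 * min 1 (‖ρ • h‖ ^ 2) := by
  have hπ : 1 ≤ Real.pi := by linarith [Real.pi_gt_three]
  have hρ0 : 0 ≤ ρ := (norm_nonneg _).trans hρ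
  have h1 : ‖phase h ξ - 1‖ ≤ 2 := by
    refine (norm_sub_le _ _).trans ?_
    rw [norm_phase, norm_one]; norm_num
  have h2 : ‖phase h ξ - 1‖ ≤ 2 * Real.pi * ‖ρ • h‖ := by
    refine Real.norm_exp_I_mul_ofReal_sub_one_le.trans ?_
    rw [norm_mul, Real.norm_of_nonneg (by positivity), norm_smul, Real.norm_of_nonneg hρ0]
    gcongr
    refine (norm_inner_le_norm _ _).trans ?_
    rw [mul_comm]
    gcongr
  rcases min_choice 1 (‖ρ • h‖ ^ 2) with h3 | h3 <;> rw [h3]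
  · nlinarith [norm_nonneg (phase h ξ - 1)]
  · calc ‖phase h ξ - 1‖ ^ 2 ≤ (2 * Real.pi * ‖ρ • h‖) ^ 2 := by gcongr
      _ = _ := by ring

/-- In polar coordinates the integrand is r^{1-2s} near zero, integrable since s < 1, and r^{-1-2s}
at infinity, integrable since s > 0. -/
theorem integrable_min_mul_fracKernel (hn : 1 ≤ n) (hs₀ : 0 < s) (hs₁ : s < 1) :
    Integrable (fun h : Rn n => min 1 (‖h‖ ^ 2) * fracKernel n s h) := by
  have : Nonempty (Fin n) := ⟨⟨0, hn⟩⟩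
  have hf := integrable_fun_norm_addHaar (volume : Measure (Rn n))
    (f := fun r : ℝ => min 1 (r ^ 2) * (r ^ ((n : ℝ) + 2 * s))⁻¹)
  refine hf.2 ?_
  rw [finrank_euclideanSpace_fin, ← Ioc_union_Ioi_eq_Ioi zero_le_one]
  have hpow : ∀ r : ℝ, 0 < r → r ^ (n - 1) * (r ^ ((n : ℝ) + 2 * s))⁻¹ = r ^ (-1 - 2 * s) := by
    intro r hr
    rw [← Real.rpow_natCast, ← Real.rpow_neg hr.le, ← Real.rpow_add hr, Nat.cast_sub hn]
    congr 1
    push_cast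
    ring
  refine IntegrableOn.union ?_ ?_
  · have h1 : IntegrableOn (fun r : ℝ => r ^ (1 - 2 * s)) (Ioc 0 1) :=
      (intervalIntegrable_iff_integrableOn_Ioc_of_le zero_le_one).1
        (intervalIntegral.intervalIntegrable_rpow' (by linarith))
    refine h1.congr_fun (fun r hr => ?_) measurableSet_Ioc
    have h2 : r ^ 2 ≤ 1 := pow_le_one₀ hr.1.le hr.2
    simp only [smul_eq_mul]
    rw [min_eq_right h2, mul_left_comm, hpow r hr.1, ← Real.rpow_natCast, ← Real.rpow_add hr.1]
    congr 1
    push_cast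
    ring
  · have h1 : IntegrableOn (fun r : ℝ => r ^ (-1 - 2 * s)) (Ioi 1) :=
      integrableOn_Ioi_rpow_of_lt (by linarith) one_pos
    refine h1.congr_fun (fun r hr => ?_) measurableSet_Ioi
    have h2 : 1 ≤ r ^ 2 := one_le_pow₀ (le_of_lt hr)
    simp only [smul_eq_mul]
    rw [min_eq_left h2, one_mul, hpow r (one_pos.trans hr)]

/-- Scaling h by ρ = √(1+|ξ|²): the kernel contributes ρ^{n+2s} and the Jacobian ρ^{-n}, leaving
ρ^{2s}. Using ρ rather than |ξ| keeps the factor positive. -/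
theorem fracSymbol_le (hn : 1 ≤ n) (hs₀ : 0 < s) (hs₁ : s < 1) :
    ∃ C : ℝ, 0 ≤ C ∧ ∀ ξ : Rn n, fracSymbol n s ξ ≤ ENNReal.ofReal (C * (1 + ‖ξ‖ ^ 2) ^ s) := by
  set g : Rn n → ℝ := fun h => min 1 (‖h‖ ^ 2) * fracKernel n s h with hg
  have hgi : Integrable g := integrable_min_mul_fracKernel hn hs₀ hs₁
  have hg0 : ∀ h, 0 ≤ g h := fun h => mul_nonneg (by positivity) (fracKernel_nonneg _ _ _)
  refine ⟨4 * Real.pi ^ 2 * ∫ h, g h, mul_nonneg (by positivity) (integral_nonneg hg0),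
    fun ξ => ?_⟩
  set ρ : ℝ := √(1 + ‖ξ‖ ^ 2) with hρ
  have hρ0 : 0 < ρ := by positivity
  have hξρ : ‖ξ‖ ≤ ρ := Real.le_sqrt_of_sq_le (by linarith)
  have hρs : ρ ^ (2 * s) = (1 + ‖ξ‖ ^ 2) ^ s := by
    rw [hρ, Real.sqrt_eq_rpow, ← Real.rpow_mul (by positivity)]
    congr 1
    ring
  have hk : ∀ h : Rn n, fracKernel n s h = ρ ^ ((n : ℝ) + 2 * s) * fracKernel n s (ρ • h) := by
    intro h
    unfold fracKernel
    rw [norm_smul, Real.norm_of_nonneg hρ0.le, Real.mul_rpow hρ0.le (norm_nonneg _), mul_inv,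
      mul_inv_cancel_left₀ (by positivity)]
  calc fracSymbol n s ξ
      ≤ ∫⁻ h, ENNReal.ofReal (4 * Real.pi ^ 2 * ρ ^ ((n : ℝ) + 2 * s) * g (ρ • h)) := by
        refine lintegral_mono fun h => ?_
        rw [← ofReal_norm, ← ENNReal.ofReal_pow (norm_nonneg _),
          ← ENNReal.ofReal_mul (fracKernel_nonneg _ _ _)]
        refine ENNReal.ofReal_le_ofReal ?_
        calc fracKernel n s h * ‖phase h ξ - 1‖ ^ 2
            ≤ fracKernel n s h * (4 * Real.pi ^ 2 * min 1 (‖ρ • h‖ ^ 2)) :=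
              mul_le_mul_of_nonneg_left (norm_phase_sub_one_sq_le h ξ hξρ)
                (fracKernel_nonneg _ _ _)
          _ = _ := by rw [hk h, hg]; ring
    _ = ENNReal.ofReal (∫ h, 4 * Real.pi ^ 2 * ρ ^ ((n : ℝ) + 2 * s) * g (ρ • h)) := by
        refine (ofReal_integral_eq_lintegral_ofReal ?_ ?_).symm
        · exact ((integrable_comp_smul_iff volume g hρ0.ne').2 hgi).const_mul _
        · exact Filter.Eventually.of_forall fun h => mul_nonneg (by positivity) (hg0 _)
    _ = _ := by
        congr 1
        rw [integral_const_mul, Measure.integral_comp_smul_of_nonneg volume g ρ (hR := hρ0.le),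
          finrank_euclideanSpace_fin, ← hρs, Real.rpow_add hρ0, Real.rpow_natCast, smul_eq_mul]
        field_simp

/-- It suffices to integrate over a ball of radius of order 1/|ξ| on which ⟪h, ξ⟫ stays in [1/8,
3/8], so that the phase stays away from 1. The kernel is at least of order |ξ|^{n+2s} there and the
volume is of order |ξ|^{-n}. -/
theorem le_fracSymbol (hn : 1 ≤ n) (hs₀ : 0 < s) :
    ∃ c : ℝ, 0 < c ∧ ∀ ξ : Rn n, ENNReal.ofReal (c * ‖ξ‖ ^ (2 * s)) ≤ fracSymbol n s ξ := by
  have : Nonempty (Fin n) := ⟨⟨0, hn⟩⟩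
  set B := (volume (Metric.ball (0 : Rn n) 1)).toReal with hB
  have hBtop : volume (Metric.ball (0 : Rn n) 1) ≠ ⊤ := measure_ball_lt_top.ne
  have hB0 : 0 < B := ENNReal.toReal_pos (Metric.measure_ball_pos _ _ one_pos).ne' hBtop
  refine ⟨((3 / 8 : ℝ) ^ ((n : ℝ) + 2 * s))⁻¹ * (1 / 4) * ((1 / 8) ^ n * B), by positivity,
    fun ξ => ?_⟩
  rcases eq_or_ne ξ 0 with rfl | hξ
  · rw [norm_zero, Real.zero_rpow (by linarith), mul_zero, ENNReal.ofReal_zero]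
    exact bot_le
  set r := ‖ξ‖ with hr
  have hr0 : 0 < r := norm_pos_iff.2 hξ
  set ζ : Rn n := (1 / (4 * r ^ 2)) • ξ with hζ
  have hζn : ‖ζ‖ = 1 / (4 * r) := by
    rw [hζ, norm_smul, Real.norm_of_nonneg (by positivity), ← hr]
    field_simp
  have hζξ : inner ℝ ζ ξ = 1 / 4 := by
    rw [hζ, real_inner_smul_left, real_inner_self_eq_norm_sq, ← hr]
    field_simp
  have hvol : volume (Metric.ball ζ (1 / (8 * r))) = ENNReal.ofReal ((1 / (8 * r)) ^ n * B) := by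
    rw [Measure.addHaar_ball _ _ (by positivity), finrank_euclideanSpace_fin,
      ENNReal.ofReal_mul (by positivity), hB, ENNReal.ofReal_toReal hBtop]
  have hpt : ∀ h ∈ Metric.ball ζ (1 / (8 * r)),
      ENNReal.ofReal (((3 / (8 * r)) ^ ((n : ℝ) + 2 * s))⁻¹ * (1 / 4)) ≤
        ENNReal.ofReal (fracKernel n s h) * ‖phase h ξ - 1‖ₑ ^ 2 := by
    intro h hh
    rw [← ofReal_norm, ← ENNReal.ofReal_pow (norm_nonneg _),
      ← ENNReal.ofReal_mul (fracKernel_nonneg _ _ _)]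
    refine ENNReal.ofReal_le_ofReal ?_
    have hd : ‖h - ζ‖ < 1 / (8 * r) := mem_ball_iff_norm.1 hh
    have h1 : |inner ℝ (h - ζ) ξ| ≤ 1 / 8 := by
      refine (abs_real_inner_le_norm _ _).trans ?_
      calc ‖h - ζ‖ * ‖ξ‖ ≤ 1 / (8 * r) * r := by gcongr
        _ = 1 / 8 := by field_simp
    have h2 : inner ℝ h ξ = 1 / 4 + inner ℝ (h - ζ) ξ := by
      rw [inner_sub_left, hζξ]; ring
    obtain ⟨h3, h4⟩ := abs_le.1 h1
    have h5 : ‖h‖ ≤ 3 / (8 * r) := by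
      calc ‖h‖ = ‖(h - ζ) + ζ‖ := by rw [sub_add_cancel]
        _ ≤ ‖h - ζ‖ + ‖ζ‖ := norm_add_le _ _
        _ ≤ 1 / (8 * r) + 1 / (4 * r) := by rw [hζn]; gcongr
        _ = 3 / (8 * r) := by field_simp; norm_num
    have h6 : 0 < ‖h‖ := by
      refine norm_pos_iff.2 fun h0 => ?_
      have h8 : inner ℝ h ξ = 0 := by rw [h0, inner_zero_left]
      linarith
    -- With t = ⟪h, ξ⟫ the norm is 2|sin πt|, and Jordan's inequality sin x ≥ 2x/π gives at least 4t
    -- ≥ 1/2.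
    have h7 : 1 / 2 ≤ ‖phase h ξ - 1‖ := by
      rw [phase, Complex.norm_exp_I_mul_ofReal_sub_one]
      have h8 := Real.mul_le_sin (x := Real.pi * inner ℝ h ξ)
        (mul_nonneg Real.pi_pos.le (by linarith)) (by nlinarith [Real.pi_pos])
      have h9 : 2 / Real.pi * (Real.pi * inner ℝ h ξ) = 2 * inner ℝ h ξ := by
        field_simp
      have h10 : 2 * Real.pi * inner ℝ h ξ / 2 = Real.pi * inner ℝ h ξ := by ring
      rw [h10]
      refine le_trans ?_ (le_abs_self _)
      linarith
    have h8 : ((3 / (8 * r)) ^ ((n : ℝ) + 2 * s))⁻¹ ≤ fracKernel n s h := by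
      unfold fracKernel
      gcongr
    have h9 : (1 / 4 : ℝ) ≤ ‖phase h ξ - 1‖ ^ 2 := by nlinarith
    exact mul_le_mul h8 h9 (by norm_num) (fracKernel_nonneg _ _ _)
  calc ENNReal.ofReal _
      = ENNReal.ofReal (((3 / (8 * r)) ^ ((n : ℝ) + 2 * s))⁻¹ * (1 / 4)) *
          volume (Metric.ball ζ (1 / (8 * r))) := by
        rw [hvol, ← ENNReal.ofReal_mul (by positivity)]
        congr 1
        have e1 : 3 / (8 * r) = 3 / 8 * r⁻¹ := by field_simp
        have e2 : 1 / (8 * r) = 1 / 8 * r⁻¹ := by field_simp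
        rw [e1, e2, Real.mul_rpow (by norm_num) (by positivity), Real.inv_rpow hr0.le,
          Real.rpow_add hr0, Real.rpow_natCast, mul_pow, inv_pow]
        field_simp
    _ = ∫⁻ _ in Metric.ball ζ (1 / (8 * r)),
          ENNReal.ofReal (((3 / (8 * r)) ^ ((n : ℝ) + 2 * s))⁻¹ * (1 / 4)) := by
        rw [setLIntegral_const]
    _ ≤ ∫⁻ h in Metric.ball ζ (1 / (8 * r)),
          ENNReal.ofReal (fracKernel n s h) * ‖phase h ξ - 1‖ₑ ^ 2 :=
        setLIntegral_mono' measurableSet_ball hpt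
    _ ≤ _ := setLIntegral_le_lintegral _ _

end Symbol

/-! ### The Gagliardo seminorm against the `H^s` norm. -/

section Bounds

variable {n : ℕ} {s : ℝ} {Ω : Set (Rn n)}

theorem Sobolev.enorm_sq (v : Sobolev n s) :
    ‖v‖ₑ ^ 2 = ∫⁻ ξ, ENNReal.ofReal ((1 + ‖ξ‖ ^ 2) ^ s) *
      ‖fourierL2 n (Sobolev.toL2 n s v) ξ‖ₑ ^ 2 := by
  have h1 : ‖v‖ₑ = ‖Sobolev.weighted n s v‖ₑ := by
    rw [← ofReal_norm, ← ofReal_norm, Sobolev.norm_eq]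
  rw [h1, Lp_enorm_sq]
  refine lintegral_congr_ae ?_
  filter_upwards [Sobolev.coeFn_weighted v] with ξ h2
  rw [h2, weightedFourier, enorm_smul, mul_pow]
  congr 1
  rw [Real.enorm_of_nonneg (by positivity), ← ENNReal.ofReal_pow (by positivity),
    ← Real.rpow_natCast, ← Real.rpow_mul (by positivity)]
  congr 2
  push_cast
  ring

theorem exists_gagliardo_le (hn : 1 ≤ n) (hs₀ : 0 < s) (hs₁ : s < 1) :
    ∃ C : ℝ, 0 ≤ C ∧ ∀ v : Sobolev n s,
      ∫⁻ p, ‖diffQuot n s (Sobolev.toL2 n s v) p‖ₑ ^ 2 ≤ ENNReal.ofReal C * ‖v‖ₑ ^ 2 := by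
  obtain ⟨C, hC, h⟩ := fracSymbol_le hn hs₀ hs₁
  refine ⟨C, hC, fun v => ?_⟩
  rw [lintegral_diffQuot_eq, Sobolev.enorm_sq, ← lintegral_const_mul' _ _ ENNReal.ofReal_ne_top]
  refine lintegral_mono fun ξ => ?_
  rw [← mul_assoc, ← ENNReal.ofReal_mul hC]
  gcongr
  exact h ξ

/-- The fractional Poincaré inequality on a bounded set. -/
theorem exists_poincare (hn : 1 ≤ n) (hs₀ : 0 < s) (hΩ : MeasurableSet Ω)
    (hΩb : Bornology.IsBounded Ω) :
    ∃ c : ℝ, 0 ≤ c ∧ ∀ v : Htilde n s Ω,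
      ∫⁻ x, ‖rep v x‖ₑ ^ 2 ≤ ENNReal.ofReal c * ∫⁻ p, ‖diffQuot n s (rep v) p‖ₑ ^ 2 := by
  have : Nonempty (Fin n) := ⟨⟨0, hn⟩⟩
  obtain ⟨R, hR0, hR⟩ := hΩb.subset_ball_lt 0 0
  obtain ⟨y₀, hy₀⟩ := exists_norm_eq (Rn n) (c := R + 1) (by linarith)
  -- A unit ball just outside the ball of radius `R` around Ω: `v` vanishes on it, and its points
  -- are within R + (R + 2) of those of Ω, so the kernel is at least `κ`. Keeping only y in `B` in
  -- the double integral gives the inequality.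
  set B := Metric.ball y₀ 1 with hB
  have hBtop : volume B ≠ ⊤ := measure_ball_lt_top.ne
  have hBpos : 0 < (volume B).toReal :=
    ENNReal.toReal_pos (Metric.measure_ball_pos _ _ one_pos).ne' hBtop
  set κ : ℝ := ((2 * R + 2) ^ ((n : ℝ) + 2 * s))⁻¹ with hκ
  have hκ0 : 0 < κ := by positivity
  have hdisj : ∀ y ∈ B, R < ‖y‖ := by
    intro y hy
    have h1 : ‖y₀ - y‖ < 1 := by rw [norm_sub_rev]; exact mem_ball_iff_norm.1 hy
    have h2 := norm_sub_norm_le y₀ y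
    linarith
  have hker : ∀ x ∈ Ω, ∀ y ∈ B, κ ≤ fracKernel n s (x - y) := by
    intro x hx y hy
    have h1 : ‖x‖ < R := mem_ball_zero_iff.1 (hR hx)
    have h2 : ‖y - y₀‖ < 1 := mem_ball_iff_norm.1 hy
    have h3 := hdisj y hy
    have h4 : ‖y‖ ≤ ‖y - y₀‖ + ‖y₀‖ := by
      simpa using norm_add_le (y - y₀) y₀
    have h5 : 0 < ‖x - y‖ := by
      refine norm_pos_iff.2 fun h => ?_
      rw [sub_eq_zero.1 h] at h1
      linarith
    have h6 : ‖x - y‖ ≤ 2 * R + 2 := (norm_sub_le _ _).trans (by linarith)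
    unfold fracKernel
    rw [hκ]
    gcongr
  refine ⟨(κ * (volume B).toReal)⁻¹, by positivity, fun v => ?_⟩
  have hv : Measurable (rep v) := (Lp.stronglyMeasurable _).measurable
  have h0 := ae_rep_eq_zero hs₀.le hΩ v
  have key : ENNReal.ofReal (κ * (volume B).toReal) * ∫⁻ x, ‖rep v x‖ₑ ^ 2 ≤
      ∫⁻ p, ‖diffQuot n s (rep v) p‖ₑ ^ 2 := by
    calc ENNReal.ofReal (κ * (volume B).toReal) * ∫⁻ x, ‖rep v x‖ₑ ^ 2
        = ∫⁻ x, ENNReal.ofReal (κ * (volume B).toReal) * ‖rep v x‖ₑ ^ 2 :=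
          (lintegral_const_mul' _ _ ENNReal.ofReal_ne_top).symm
      _ ≤ ∫⁻ x, ∫⁻ y, ‖diffQuot n s (rep v) (x, y)‖ₑ ^ 2 := by
          refine lintegral_mono_ae ?_
          filter_upwards [h0] with x hx
          by_cases hxΩ : x ∈ Ω
          · calc ENNReal.ofReal (κ * (volume B).toReal) * ‖rep v x‖ₑ ^ 2
                = ∫⁻ _ in B, ENNReal.ofReal κ * ‖rep v x‖ₑ ^ 2 := by
                  rw [setLIntegral_const, ENNReal.ofReal_mul hκ0.le,
                    ENNReal.ofReal_toReal hBtop]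
                  ring
              _ ≤ ∫⁻ y in B, ‖diffQuot n s (rep v) (x, y)‖ₑ ^ 2 := by
                  refine lintegral_mono_ae ?_
                  filter_upwards [ae_restrict_of_ae h0, ae_restrict_mem measurableSet_ball]
                    with y hy hyB
                  have hyΩ : y ∉ Ω := fun h => by
                    have h1 := mem_ball_zero_iff.1 (hR h)
                    have h2 := hdisj y hyB
                    linarith
                  rw [enorm_diffQuot_sq, hy hyΩ, sub_zero]
                  gcongr
                  exact hker x hxΩ y hyB
              _ ≤ _ := setLIntegral_le_lintegral _ _
          · simp [hx hxΩ]
      _ = ∫⁻ p, ‖diffQuot n s (rep v) p‖ₑ ^ 2 :=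
          (lintegral_prod _ ((measurable_diffQuot hv).enorm.pow_const 2).aemeasurable).symm
  calc ∫⁻ x, ‖rep v x‖ₑ ^ 2
      = ENNReal.ofReal (κ * (volume B).toReal)⁻¹ *
          (ENNReal.ofReal (κ * (volume B).toReal) * ∫⁻ x, ‖rep v x‖ₑ ^ 2) := by
        rw [← mul_assoc, ← ENNReal.ofReal_mul (by positivity), inv_mul_cancel₀ (by positivity),
          ENNReal.ofReal_one, one_mul]
    _ ≤ _ := by gcongr

/-- Since (1+|ξ|²)^s ≤ 1 + |ξ|^{2s}, the norm splits into an `L²` part, controlled by Poincaré, and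
a part controlled by the lower bound of the symbol. -/
theorem exists_norm_le_gagliardo (hn : 1 ≤ n) (hs₀ : 0 < s) (hs₁ : s < 1)
    (hΩ : MeasurableSet Ω) (hΩb : Bornology.IsBounded Ω) :
    ∃ c : ℝ, 0 < c ∧ ∀ v : Htilde n s Ω,
      ‖v‖ₑ ^ 2 ≤ ENNReal.ofReal c * ∫⁻ p, ‖diffQuot n s (rep v) p‖ₑ ^ 2 := by
  obtain ⟨c₁, hc₁, h₁⟩ := exists_poincare hn hs₀ hΩ hΩb
  obtain ⟨c₂, hc₂, h₂⟩ := le_fracSymbol (s := s) hn hs₀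
  refine ⟨c₁ + c₂⁻¹, by positivity, fun v => ?_⟩
  set F := fourierL2 n (Sobolev.toL2 n s (v : Sobolev n s)) with hF
  have hFm : Measurable F := (Lp.stronglyMeasurable _).measurable
  have e1 : ∫⁻ ξ, ‖F ξ‖ₑ ^ 2 = ∫⁻ x, ‖rep v x‖ₑ ^ 2 := by
    have h3 : ‖F‖ₑ = ‖Sobolev.toL2 n s (v : Sobolev n s)‖ₑ := by
      rw [← ofReal_norm, ← ofReal_norm, hF, norm_fourierL2]
    rw [← Lp_enorm_sq, h3, Lp_enorm_sq]
    rfl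
  have e2 : ‖v‖ₑ = ‖(v : Sobolev n s)‖ₑ := rfl
  rw [e2, Sobolev.enorm_sq]
  calc ∫⁻ ξ, ENNReal.ofReal ((1 + ‖ξ‖ ^ 2) ^ s) * ‖F ξ‖ₑ ^ 2
      ≤ ∫⁻ ξ, (‖F ξ‖ₑ ^ 2 + ENNReal.ofReal c₂⁻¹ * (fracSymbol n s ξ * ‖F ξ‖ₑ ^ 2)) := by
        refine lintegral_mono fun ξ => ?_
        have h3 : (1 + ‖ξ‖ ^ 2) ^ s ≤ 1 + ‖ξ‖ ^ (2 * s) := by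
          refine (Real.rpow_add_le_add_rpow zero_le_one (by positivity) hs₀.le hs₁.le).trans ?_
          rw [Real.one_rpow, ← Real.rpow_natCast, ← Real.rpow_mul (norm_nonneg _)]
          norm_num
        have h4 : ENNReal.ofReal (‖ξ‖ ^ (2 * s)) ≤ ENNReal.ofReal c₂⁻¹ * fracSymbol n s ξ := by
          calc ENNReal.ofReal (‖ξ‖ ^ (2 * s))
              = ENNReal.ofReal c₂⁻¹ * ENNReal.ofReal (c₂ * ‖ξ‖ ^ (2 * s)) := by
                rw [← ENNReal.ofReal_mul (by positivity), inv_mul_cancel_left₀ hc₂.ne']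
            _ ≤ _ := by gcongr; exact h₂ ξ
        calc ENNReal.ofReal ((1 + ‖ξ‖ ^ 2) ^ s) * ‖F ξ‖ₑ ^ 2
            ≤ (1 + ENNReal.ofReal c₂⁻¹ * fracSymbol n s ξ) * ‖F ξ‖ₑ ^ 2 := by
              gcongr
              refine (ENNReal.ofReal_le_ofReal h3).trans ?_
              rw [ENNReal.ofReal_add zero_le_one (by positivity), ENNReal.ofReal_one]
              gcongr
          _ = _ := by ring
    _ = (∫⁻ x, ‖rep v x‖ₑ ^ 2) +
          ENNReal.ofReal c₂⁻¹ * ∫⁻ p, ‖diffQuot n s (rep v) p‖ₑ ^ 2 := by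
        rw [lintegral_add_left (by fun_prop), lintegral_const_mul' _ _ ENNReal.ofReal_ne_top, e1]
        congr 2
        exact (lintegral_diffQuot_eq s (Sobolev.toL2 n s (v : Sobolev n s))).symm
    _ ≤ ENNReal.ofReal c₁ * (∫⁻ p, ‖diffQuot n s (rep v) p‖ₑ ^ 2) +
          ENNReal.ofReal c₂⁻¹ * ∫⁻ p, ‖diffQuot n s (rep v) p‖ₑ ^ 2 := by gcongr; exact h₁ v
    _ = _ := by rw [← add_mul, ENNReal.ofReal_add hc₁ (by positivity)]

end Bounds

/-! ### The form 𝓐: boundedness, symmetry and coercivity. -/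

section BilinearForm

variable {n : ℕ} {s : ℝ} {Ω : Set (Rn n)}

theorem memLp_diffQuot (hn : 1 ≤ n) (hs₀ : 0 < s) (hs₁ : s < 1) (v : Sobolev n s) :
    MemLp (diffQuot n s (Sobolev.toL2 n s v)) 2 volume := by
  obtain ⟨C, hC, h⟩ := exists_gagliardo_le hn hs₀ hs₁
  refine ⟨(measurable_diffQuot (Lp.stronglyMeasurable _).measurable).aestronglyMeasurable, ?_⟩
  rw [eLpNorm_lt_top_iff_lintegral_rpow_enorm_lt_top (by norm_num) (by norm_num)]
  simp only [ENNReal.toReal_ofNat, ENNReal.rpow_ofNat]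
  exact (h v).trans_lt (by finiteness)

/-- The difference quotient as a linear map from `H^s(ℝⁿ)` to `L²(ℝⁿ × ℝⁿ)`. -/
noncomputable def diffQuotLp (hn : 1 ≤ n) (hs₀ : 0 < s) (hs₁ : s < 1) :
    Sobolev n s →ₗ[ℝ] Lp ℝ 2 (volume : Measure (Rn n × Rn n)) where
  toFun v := (memLp_diffQuot hn hs₀ hs₁ v).toLp _
  map_add' v w := by
    rw [← MemLp.toLp_add]
    refine MemLp.toLp_congr _ _ ?_
    have h := Lp.coeFn_add (Sobolev.toL2 n s v) (Sobolev.toL2 n s w)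
    filter_upwards [Measure.quasiMeasurePreserving_fst.ae h,
      Measure.quasiMeasurePreserving_snd.ae h] with p h1 h2
    rw [Pi.add_apply, diffQuot, diffQuot, diffQuot, map_add, h1, h2, Pi.add_apply, Pi.add_apply]
    ring
  map_smul' c v := by
    rw [RingHom.id_apply, ← MemLp.toLp_const_smul]
    refine MemLp.toLp_congr _ _ ?_
    have h := Lp.coeFn_smul c (Sobolev.toL2 n s v)
    filter_upwards [Measure.quasiMeasurePreserving_fst.ae h,
      Measure.quasiMeasurePreserving_snd.ae h] with p h1 h2
    rw [Pi.smul_apply, diffQuot, diffQuot, map_smul, h1, h2, Pi.smul_apply, Pi.smul_apply,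
      smul_eq_mul, smul_eq_mul, smul_eq_mul]
    ring

theorem coeFn_diffQuotLp (hn : 1 ≤ n) (hs₀ : 0 < s) (hs₁ : s < 1) (v : Sobolev n s) :
    diffQuotLp hn hs₀ hs₁ v =ᵐ[volume] diffQuot n s (Sobolev.toL2 n s v) :=
  (memLp_diffQuot hn hs₀ hs₁ v).coeFn_toLp

theorem enorm_diffQuotLp_sq (hn : 1 ≤ n) (hs₀ : 0 < s) (hs₁ : s < 1) (v : Sobolev n s) :
    ‖diffQuotLp hn hs₀ hs₁ v‖ₑ ^ 2 =
      ∫⁻ p, ‖diffQuot n s (Sobolev.toL2 n s v) p‖ₑ ^ 2 := by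
  rw [Lp_enorm_sq]
  exact lintegral_congr_ae ((coeFn_diffQuotLp hn hs₀ hs₁ v).mono fun p hp => by simp only [hp])

theorem norm_sq_le_of_enorm_sq_le {X Y : Type*} [NormedAddCommGroup X] [NormedAddCommGroup Y]
    {x : X} {y : Y} {C : ℝ} (hC : 0 ≤ C) (h : ‖x‖ₑ ^ 2 ≤ ENNReal.ofReal C * ‖y‖ₑ ^ 2) :
    ‖x‖ ^ 2 ≤ C * ‖y‖ ^ 2 := by
  rw [← ofReal_norm, ← ofReal_norm, ← ENNReal.ofReal_pow (norm_nonneg _),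
    ← ENNReal.ofReal_pow (norm_nonneg _), ← ENNReal.ofReal_mul hC] at h
  exact (ENNReal.ofReal_le_ofReal_iff (by positivity)).1 h

theorem exists_norm_diffQuotLp_le (hn : 1 ≤ n) (hs₀ : 0 < s) (hs₁ : s < 1) :
    ∃ C : ℝ, ∀ v, ‖diffQuotLp hn hs₀ hs₁ v‖ ≤ C * ‖v‖ := by
  obtain ⟨C, hC, h⟩ := exists_gagliardo_le hn hs₀ hs₁
  refine ⟨√C, fun v => ?_⟩
  have h1 := norm_sq_le_of_enorm_sq_le hC ((enorm_diffQuotLp_sq hn hs₀ hs₁ v).trans_le (h v))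
  refine abs_le_of_sq_le_sq' ?_ (by positivity) |>.2
  rwa [mul_pow, Real.sq_sqrt hC]

theorem constC_pos (n : ℕ) (hs₀ : 0 < s) (hs₁ : s < 1) : 0 < constC n s := by
  have h1 : 0 < Real.Gamma (s + n / 2) := Real.Gamma_pos_of_pos (by positivity)
  have h2 : 0 < Real.Gamma (1 - s) := Real.Gamma_pos_of_pos (by linarith)
  unfold constC
  positivity

/-- `𝓐` as a bounded bilinear form on `H̃^s(Ω)`. -/
noncomputable def formCLM (hn : 1 ≤ n) (hs₀ : 0 < s) (hs₁ : s < 1) (Ω : Set (Rn n)) :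
    Htilde n s Ω →L[ℝ] Htilde n s Ω →L[ℝ] ℝ :=
  (constC n s / 2) • pullInner
    (((diffQuotLp hn hs₀ hs₁).mkContinuousOfExistsBound (exists_norm_diffQuotLp_le hn hs₀ hs₁)) ∘L
      (Htilde n s Ω).subtypeL)

theorem formCLM_eq_inner (hn : 1 ≤ n) (hs₀ : 0 < s) (hs₁ : s < 1) (v w : Htilde n s Ω) :
    formCLM hn hs₀ hs₁ Ω v w = constC n s / 2 *
      inner ℝ (diffQuotLp hn hs₀ hs₁ (v : Sobolev n s)) (diffQuotLp hn hs₀ hs₁ (w : Sobolev n s)) :=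
  rfl

theorem formCLM_apply (hn : 1 ≤ n) (hs₀ : 0 < s) (hs₁ : s < 1) (v w : Htilde n s Ω) :
    formCLM hn hs₀ hs₁ Ω v w = formA n s (rep v) (rep w) := by
  rw [formCLM_eq_inner, formA, L2.inner_def]
  congr 1
  refine integral_congr_ae ?_
  filter_upwards [coeFn_diffQuotLp hn hs₀ hs₁ (v : Sobolev n s),
    coeFn_diffQuotLp hn hs₀ hs₁ (w : Sobolev n s)] with p h1 h2
  rw [h1, h2, ← diffQuot_sq, Real.inner_apply]
  rfl

theorem formCLM_symm (hn : 1 ≤ n) (hs₀ : 0 < s) (hs₁ : s < 1) (v w : Htilde n s Ω) :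
    formCLM hn hs₀ hs₁ Ω v w = formCLM hn hs₀ hs₁ Ω w v := by
  rw [formCLM_eq_inner, formCLM_eq_inner, real_inner_comm]

theorem exists_formCLM_coercive (hn : 1 ≤ n) (hs₀ : 0 < s) (hs₁ : s < 1)
    (hΩ : MeasurableSet Ω) (hΩb : Bornology.IsBounded Ω) :
    ∃ α : ℝ, 0 < α ∧ ∀ v, α * ‖v‖ ^ 2 ≤ formCLM hn hs₀ hs₁ Ω v v := by
  obtain ⟨c, hc, h⟩ := exists_norm_le_gagliardo hn hs₀ hs₁ hΩ hΩb
  have hC := constC_pos n hs₀ hs₁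
  refine ⟨constC n s / 2 * c⁻¹, by positivity, fun v => ?_⟩
  have h1 := norm_sq_le_of_enorm_sq_le hc.le
    ((h v).trans_eq (congrArg _ (enorm_diffQuotLp_sq hn hs₀ hs₁ (v : Sobolev n s)).symm))
  rw [formCLM_eq_inner, real_inner_self_eq_norm_sq, mul_assoc]
  gcongr
  rwa [inv_mul_le_iff₀ hc]

end BilinearForm

/-! ### From the abstract problem to weak solutions. -/

section WeakSolutions

variable {n : ℕ} {s : ℝ} {Ω : Set (Rn n)}

theorem integrable_mul_clm {X : Type} [NormedAddCommGroup X] [NormedSpace ℝ X] {T : ℝ}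
    {k : ℝ → ℝ} (hk : MemLp k 2 (volume.restrict (Ioo 0 T))) (ℓ : X →L[ℝ] ℝ)
    (f : L2Time T X) : Integrable (fun t => k t * ℓ (f t)) (volume.restrict (Ioo 0 T)) :=
  hk.integrable_mul (ℓ.comp_memLp f)

theorem IsDistribSolution.sub {V H : Type} [NormedAddCommGroup V] [InnerProductSpace ℝ V]
    [NormedAddCommGroup H] [InnerProductSpace ℝ H] {j : V →L[ℝ] H} {a : V →L[ℝ] V →L[ℝ] ℝ}
    {T : ℝ} {F : L2Time T (StrongDual ℝ V)} {u w : L2Time T V}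
    (hu : IsDistribSolution j a F u) (hw : IsDistribSolution j a F w) :
    IsDistribSolution j a 0 (u - w) := by
  intro η h1 h2 h3 φ
  have hmem : ∀ k : ℝ → ℝ, Continuous k → HasCompactSupport k →
      MemLp k 2 (volume.restrict (Ioo 0 T)) := fun k hk hkc =>
    (hk.memLp_of_hasCompactSupport hkc).restrict _
  have hη := hmem η h1.continuous h2
  have hη' := hmem _ (contDiff_infty_iff_deriv.1 h1).2.continuous h2.deriv
  have e1 : ∫ t in Ioo 0 T, deriv η t * inner ℝ (j ((u - w) t)) (j φ) =
      (∫ t in Ioo 0 T, deriv η t * inner ℝ (j (u t)) (j φ)) -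
        ∫ t in Ioo 0 T, deriv η t * inner ℝ (j (w t)) (j φ) := by
    refine Eq.trans (integral_congr_ae ?_) (integral_sub
      (integrable_mul_clm hη' ((pullInner j).flip φ) u)
      (integrable_mul_clm hη' ((pullInner j).flip φ) w))
    filter_upwards [Lp.coeFn_sub u w] with t ht
    rw [ht, Pi.sub_apply, map_sub, inner_sub_left, mul_sub]
  have e3 : ∫ t in Ioo 0 T, η t * residual a 0 (u - w) t φ =
      (∫ t in Ioo 0 T, η t * residual a F u t φ) - ∫ t in Ioo 0 T, η t * residual a F w t φ := by
    refine Eq.trans (integral_congr_ae ?_) (integral_sub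
      (integrable_mul_clm hη (ContinuousLinearMap.apply ℝ ℝ φ) (residual a F u))
      (integrable_mul_clm hη (ContinuousLinearMap.apply ℝ ℝ φ) (residual a F w)))
    filter_upwards [Lp.coeFn_sub u w, coeFn_residual a 0 (u - w), coeFn_residual a F u,
      coeFn_residual a F w, Lp.coeFn_zero (StrongDual ℝ V) 2 (volume.restrict (Ioo 0 T))]
      with t h4 h5 h6 h7 h8
    rw [h5, h4, h8, h6, h7,
      ← mul_sub, ← sub_apply, Pi.sub_apply, Pi.zero_apply, map_sub]
    congr 2
    abel
  rw [e1, e3, hu η h1 h2 h3 φ, hw η h1 h2 h3 φ]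
  ring

theorem isDistribSolution_iff_isTimeDeriv (hs₀ : 0 < s) {T : ℝ}
    (a : Htilde n s Ω →L[ℝ] Htilde n s Ω →L[ℝ] ℝ) (F : L2Time T (Hneg n s Ω))
    (u : L2Time T (Htilde n s Ω)) :
    IsDistribSolution (restrL n hs₀.le Ω) a F u ↔
      IsTimeDeriv u (residual a F u) :=
  Iff.rfl

/-- The pointwise equation determines the time derivative: `g` has to be the residual f + z - 𝓐(u,
·). -/
theorem IsWeakSolution.isDistribSolution (hn : 1 ≤ n) (hs₀ : 0 < s) (hs₁ : s < 1) {T : ℝ}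
    {f z : L2Time T (Hneg n s Ω)} {u₀ : L2 n Ω} {u : L2Time T (Htilde n s Ω)}
    (h : IsWeakSolution f z u₀ u) :
    IsDistribSolution (restrL n hs₀.le Ω) (formCLM hn hs₀ hs₁ Ω) (f + z) u := by
  obtain ⟨-, -, g, hg, hw⟩ := h
  rw [isDistribSolution_iff_isTimeDeriv hs₀]
  convert hg
  refine Lp.ext ?_
  filter_upwards [hw, coeFn_residual (formCLM hn hs₀ hs₁ Ω) (f + z) u, Lp.coeFn_add f z]
    with t h1 h2 h3
  rw [h2, h3, Pi.add_apply]
  ext φ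
  rw [sub_apply, formCLM_apply, ← h1 φ, add_sub_cancel_right]

theorem isWeakSolution_unique (hn : 1 ≤ n) (hs₀ : 0 < s) (hs₁ : s < 1) (hΩ : MeasurableSet Ω)
    (hΩb : Bornology.IsBounded Ω) {T : ℝ} (hT : 0 < T) {f z : L2Time T (Hneg n s Ω)}
    {u₀ : L2 n Ω} {u w : L2Time T (Htilde n s Ω)}
    (hu : IsWeakSolution f z u₀ u) (hw : IsWeakSolution f z u₀ w) : u = w := by
  obtain ⟨α, hα, hco⟩ := exists_formCLM_coercive hn hs₀ hs₁ hΩ hΩb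
  have : CompleteSpace (Sobolev n s) := Sobolev.completeSpace n hs₀.le
  obtain ⟨U, hU, hUu, hU0⟩ := hu.2.1
  obtain ⟨W, hW, hWw, hW0⟩ := hw.2.1
  refine sub_eq_zero.1 (distribSolution_unique (restrL n hs₀.le Ω) (restrL_injective hs₀.le hΩ)
    (formCLM hn hs₀ hs₁ Ω) (formCLM_symm hn hs₀ hs₁)
    (fun v => (by positivity : 0 ≤ α * ‖v‖ ^ 2).trans (hco v)) hT (u - w)
    ((hu.isDistribSolution hn hs₀ hs₁).sub (hw.isDistribSolution hn hs₀ hs₁))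
    (fun t => U t - W t) (hU.sub hW) ?_ (by rw [hU0, hW0, sub_self]))
  filter_upwards [hUu, hWw, Lp.coeFn_sub u w] with t h1 h2 h3
  rw [h1, h2, h3, Pi.sub_apply, map_sub]
  rfl

theorem exists_isWeakSolution (hn : 1 ≤ n) (hs₀ : 0 < s) (hs₁ : s < 1) (hΩ : IsOpen Ω)
    {α : ℝ} (hα : 0 < α) (hco : ∀ v, α * ‖v‖ ^ 2 ≤ formCLM hn hs₀ hs₁ Ω v v) {T : ℝ}
    (hT : 0 < T) (f z : L2Time T (Hneg n s Ω)) (u₀ : L2 n Ω) :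
    ∃ u : L2Time T (Htilde n s Ω), IsWeakSolution f z u₀ u ∧
      (∀ᵐ t ∂(volume.restrict (Ioo 0 T)),
        ‖restr n s Ω (u t)‖ ^ 2 ≤ ‖u₀‖ ^ 2 + α⁻¹ * ‖f + z‖ ^ 2) ∧
      α * ‖u‖ ^ 2 ≤ ‖u₀‖ ^ 2 + α⁻¹ * ‖f + z‖ ^ 2 := by
  have : CompleteSpace (Sobolev n s) := Sobolev.completeSpace n hs₀.le
  obtain ⟨u, U, h1, h2, h3, h4, h5⟩ := exists_distribSolution (restrL n hs₀.le Ω)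
    (restrL_injective hs₀.le hΩ.measurableSet) (denseRange_restrL hs₀.le hΩ)
    (formCLM hn hs₀ hs₁ Ω) (formCLM_symm hn hs₀ hs₁) hα hco hT (f + z) u₀
  rw [isDistribSolution_iff_isTimeDeriv hs₀] at h1
  have hb : ∀ᵐ t ∂(volume.restrict (Ioo 0 T)),
      ‖restr n s Ω (u t)‖ ^ 2 ≤ ‖u₀‖ ^ 2 + α⁻¹ * ‖f + z‖ ^ 2 := by
    filter_upwards [h2] with t ht
    have h6 := h4 t
    rwa [ht] at h6
  refine ⟨u, ⟨⟨?_, _, h1⟩, ⟨U, U.continuous.continuousOn, h2, h3⟩, _, h1, ?_⟩, hb, h5⟩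
  · refine memLp_top_of_bound ((restrL n hs₀.le Ω).continuous.comp_aestronglyMeasurable
      (Lp.aestronglyMeasurable u)) (√(‖u₀‖ ^ 2 + α⁻¹ * ‖f + z‖ ^ 2)) ?_
    filter_upwards [hb] with t ht
    exact Real.le_sqrt_of_sq_le ht
  · filter_upwards [coeFn_residual (formCLM hn hs₀ hs₁ Ω) (f + z) u, Lp.coeFn_add f z]
      with t h6 h7 φ
    rw [h6, h7, Pi.add_apply, sub_apply, formCLM_apply, sub_add_cancel]

end WeakSolutions

end FracHeat

/-! ### Well-posedness and the estimate uniform in `T`. -/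

theorem theorem3p1 (n : ℕ) (hn : 1 ≤ n) (s : ℝ) (hs₀ : 0 < s) (hs₁ : s < 1)
    (Ω : Set (FracHeat.Rn n)) (hΩ : IsOpen Ω) (hΩb : Bornology.IsBounded Ω) :
    (∀ (T : ℝ), 0 < T →
      ∀ (f z : FracHeat.L2Time T (FracHeat.Hneg n s Ω)) (u₀ : FracHeat.L2 n Ω),
        ∃! u : FracHeat.L2Time T (FracHeat.Htilde n s Ω), FracHeat.IsWeakSolution f z u₀ u) ∧
    ∃ C : ℝ, 0 < C ∧ ∀ (T : ℝ), 0 < T →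
      ∀ (f z : FracHeat.L2Time T (FracHeat.Hneg n s Ω)) (u₀ : FracHeat.L2 n Ω)
        (u : FracHeat.L2Time T (FracHeat.Htilde n s Ω)), FracHeat.IsWeakSolution f z u₀ u →
        eLpNorm (fun t => FracHeat.restr n s Ω (u t)) ∞ (volume.restrict (Ioo 0 T)) +
            eLpNorm (fun t => u t) 2 (volume.restrict (Ioo 0 T)) ≤
          ENNReal.ofReal (C * Real.sqrt (‖u₀‖ ^ 2 + ‖f + z‖ ^ 2)) := by
  have hΩm := hΩ.measurableSet
  obtain ⟨α, hα, hco⟩ := FracHeat.exists_formCLM_coercive hn hs₀ hs₁ hΩm hΩb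
  -- The coercivity constant `α` is fixed before `T` and the data. The factor `√(max 1 α⁻¹)`
  -- compares the energy bound with the unweighted data norm; the summands `1` and `√α⁻¹` belong to
  -- the L^∞ and L² norms.
  refine ⟨fun T hT f z u₀ => ?_, √(max 1 α⁻¹) * (1 + √α⁻¹), by positivity,
    fun T hT f z u₀ u hu => ?_⟩
  · obtain ⟨u, hu, -⟩ := FracHeat.exists_isWeakSolution hn hs₀ hs₁ hΩ hα hco hT f z u₀
    exact ⟨u, hu, fun w hw => FracHeat.isWeakSolution_unique hn hs₀ hs₁ hΩm hΩb hT hw hu⟩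
  · obtain ⟨w, hw, hb, hn2⟩ := FracHeat.exists_isWeakSolution hn hs₀ hs₁ hΩ hα hco hT f z u₀
    -- The bounds are known for the constructed solution only; uniqueness transfers them to the
    -- given one.
    obtain rfl := FracHeat.isWeakSolution_unique hn hs₀ hs₁ hΩm hΩb hT hu hw
    set D := √(‖u₀‖ ^ 2 + ‖f + z‖ ^ 2) with hD
    set K := √(max 1 α⁻¹) * D with hK
    have hK0 : 0 ≤ K := by positivity
    have hK2 : ‖u₀‖ ^ 2 + α⁻¹ * ‖f + z‖ ^ 2 ≤ K ^ 2 := by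
      rw [hK, hD, mul_pow, Real.sq_sqrt (by positivity), Real.sq_sqrt (by positivity), mul_add]
      refine add_le_add (le_mul_of_one_le_left (by positivity) (le_max_left _ _)) ?_
      gcongr
      exact le_max_right _ _
    have h1 : eLpNorm (fun t => FracHeat.restr n s Ω (u t)) ⊤ (volume.restrict (Ioo 0 T)) ≤
        ENNReal.ofReal K := by
      rw [eLpNorm_exponent_top]
      refine eLpNormEssSup_le_of_ae_bound ?_
      filter_upwards [hb] with t ht
      exact abs_le_of_sq_le_sq' (ht.trans hK2) hK0 |>.2
    have h2 : eLpNorm (fun t => u t) 2 (volume.restrict (Ioo 0 T)) ≤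
        ENNReal.ofReal (√α⁻¹ * K) := by
      have e : eLpNorm (fun t => u t) 2 (volume.restrict (Ioo 0 T)) = ENNReal.ofReal ‖u‖ := by
        rw [Lp.norm_def, ENNReal.ofReal_toReal (Lp.eLpNorm_ne_top u)]
      rw [e]
      refine ENNReal.ofReal_le_ofReal (abs_le_of_sq_le_sq' ?_ (by positivity) |>.2)
      rw [mul_pow, Real.sq_sqrt (by positivity)]
      calc ‖u‖ ^ 2 = α⁻¹ * (α * ‖u‖ ^ 2) := by field_simp
        _ ≤ α⁻¹ * K ^ 2 := by gcongr; exact hn2.trans hK2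
    refine (add_le_add h1 h2).trans_eq ?_
    rw [← ENNReal.ofReal_add hK0 (by positivity)]
    congr 1
    rw [hK]
    ring
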